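/- Let $\mathsf H$ be a quaternionic right Hilbert space with scalar product $\langle u|v\rangle$ (right $\mathbb H$-linear in $v$), and let $\mathfrak B(\mathsf H)$ be the set of its continuous right $\mathbb H$-linear operators. Let $\mathbb S=\{q\in\mathbb H: q^2=-1\}$ and, for $\imath\in\mathbb S$, let $\mathbb C^+_\imath=\{\alpha+\imath\beta:\alpha,\beta\in\mathbb R,\ \beta\ge 0\}$ with its Borel $\sigma$-algebra $\mathscr B(\mathbb C_\imath^+)$. An iqPVM over $\mathbb C^+_\imath$ in $\mathsf H$ is a pair $\mathcal P=(P,\mathcal L)$ such that: * $P:\mathscr B(\mathbb C^+_\imath)\to\mathfrak B(\mathsf H)$ satisfies $P(\mathbb C^+_\imath)=\mathrm I$, $P(E)P(E')=P(E\cap E')$, $P(\bigcup_n E_n)u=\sum_n P(E_n)u$ for every $u\in\mathsf H$ and all countable families of pairwise disjoint Borel sets $E_n$, and $\langle u|P(E)u\rangle\in[0,\infty)$ for every $u\in\mathsf H$; * $\mathcal L:q\mapsto L_q$ is the left scalar multiplication induced by some Hilbert basis $N$ of $\mathsf H$, i.e. $L_qu=\sum_{z\in N}zq\langle z|u\rangle$;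 * $P(E)L_q=L_qP(E)$ for all $E\in\mathscr B(\mathbb C^+_\imath)$ and $q\in\mathbb H$. Put $\mu_u(E)=\langle u|P(E)u\rangle$, a finite Borel measure. For a simple function $s=\sum_\ell S_\ell\chi_{E_\ell}$ (the $E_\ell$ disjoint Borel sets, $S_\ell\in\mathbb H$) put $\int s\,d\mathcal P=\sum_\ell L_{S_\ell}P(E_\ell)$. For bounded measurable $\varphi:\mathbb C_\imath^+\to\mathbb H$ let $\int\varphi\,d\mathcal P\in\mathfrak B(\mathsf H)$ be the operator-norm limit of $\int s_n\,d\mathcal P$ for any sequence of simple functions $s_n\to\varphi$ uniformly. For measurable $f:\mathbb C_\imath^+\to\mathbb H$ let $D_f=\{u\in\mathsf H: f\in L^2(\mu_u)\}$, let $f_n=f$ where $|f|\le n$ and $f_n=0$ elsewhere, and put $\int f\,d\mathcal P\,u=\lim_{n}\int f_n\,d\mathcal P\,u$ for $u\in D_f$. Call $f$ $P$-essentially bounded if $P(\{|f|>k\})=0$ for some $k\in[0,\infty)$. Operators $T$, $S$ with domains $D(T)$, $D(S)$ are added on $D(T+S)=D(T)\cap D(S)$ and composed on $D(TS)=\{u\in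 D(S): Su\in D(T)\}$; $T\subset S$ means that $S$ extends $T$; and $T^*$ is the adjoint of a densely defined $T$. **Theorem.** Let $\mathcal P=(P,\mathcal L)$ be an iqPVM over $\mathbb C^+_\imath$ in $\mathsf H$ and let $f,g:\mathbb C^+_\imath\to\mathbb H$ be measurable. Then $D_f$ is a dense right $\mathbb H$-linear subspace of $\mathsf H$, $\int f\,d\mathcal P$ is a well-defined right $\mathbb H$-linear operator with domain $D_f$, and if $f$ is bounded it coincides with the (well-defined) bounded integral. Moreover: (a) $D\big(\int f\,d\mathcal P\int g\,d\mathcal P\big)=D_g\cap D_{fg}$ and $\int f\,d\mathcal P\int g\,d\mathcal P\subset\int fg\,d\mathcal P$, with equality if and only if $D_{fg}\subset D_g$. (b) $D\big(\int f\,d\mathcal P+\int g\,d\mathcal P\big)=D_f\cap D_g$ and $\int f\,d\mathcal P+\int g\,d\mathcal P\subset\int (f+g)\,d\mathcal P$, with equality if and only if $D_{f+g}\subset D_f\cap D_g$. (c) $D_f=D_{\bar f}$ and $\big(\int f\,d\mathcal P\big)^*=\int\bar f\,d\mathcal P$. In particular $\int f\,d\mathcal P$ is a closed operator. (d) $\int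 f\,d\mathcal P$ is normal, and $\big(\int f\,d\mathcal P\big)^*\big(\int f\,d\mathcal P\big)=\int|f|^2\,d\mathcal P=\big(\int f\,d\mathcal P\big)\big(\int f\,d\mathcal P\big)^*$. (e) $D_f=\mathsf H$ if and only if $f$ is $P$-essentially bounded. In particular, equality holds in the inclusion of (a) if $g$ is $P$-essentially bounded, and in that of (b) if at least one of $f$ and $g$ is $P$-essentially bounded. (f) Let $\jmath\in\mathbb S$, let $\Psi:\mathbb C^+_\imath\to\mathbb C^+_\jmath$ be measurable and let $Q(E)=P(\Psi^{-1}(E))$ for $E\in\mathscr B(\mathbb C^+_\jmath)$. Then $\mathcal Q=(Q,\mathcal L)$ is an iqPVM over $\mathbb C^+_\jmath$ in $\mathsf H$, and $\int_{\mathbb C^+_\imath}\xi\circ\Psi\,d\mathcal P=\int_{\mathbb C^+_\jmath}\xi\,d\mathcal Q$ for every measurable $\xi:\mathbb C^+_\jmath\to\mathbb H$. -/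

import Mathlib

open MeasureTheory Filter Topology
open scoped Quaternion ENNReal NNReal

/-- The quaternions carry their Borel `σ`-algebra. -/
noncomputable instance Quaternion.instMeasurableSpaceBorel : MeasurableSpace ℍ[ℝ] := borel ℍ[ℝ]

instance Quaternion.instBorelSpaceReal : BorelSpace ℍ[ℝ] := ⟨rfl⟩

namespace QuaternionicIntegral

noncomputable section

/-! ### Quaternionic Hilbert spaces -/

/-- The Hermitian scalar product of a quaternionic right Hilbert space. The right scalar
multiplication `u q` is the action `MulOpposite.op q • u` of the opposite ring; the norm of `H` is
the one given by the scalar product. Completeness is required separately by `CompleteSpace H`. -/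
class QInnerProductSpace (H : Type*) [NormedAddCommGroup H] [Module ℍ[ℝ]ᵐᵒᵖ H] where
  qinner : H → H → ℍ[ℝ]
  qinner_add_right : ∀ u v w : H, qinner u (v + w) = qinner u v + qinner u w
  qinner_smul_right : ∀ (u v : H) (q : ℍ[ℝ]),
    qinner u (MulOpposite.op q • v) = qinner u v * q
  qinner_conj : ∀ u v : H, qinner u v = star (qinner v u)
  qinner_self : ∀ u : H, qinner u u = ((‖u‖ ^ 2 : ℝ) : ℍ[ℝ])

section Hilbert

variable {H : Type*} [NormedAddCommGroup H] [Module ℍ[ℝ]ᵐᵒᵖ H] [QInnerProductSpace H]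

/-- The scalar product `⟨u | v⟩`. -/
def qinner (u v : H) : ℍ[ℝ] := QInnerProductSpace.qinner u v

theorem qinner_add_right (u v w : H) : qinner u (v + w) = qinner u v + qinner u w :=
  QInnerProductSpace.qinner_add_right u v w

theorem qinner_smul_right (u v : H) (q : ℍ[ℝ]) :
    qinner u (MulOpposite.op q • v) = qinner u v * q :=
  QInnerProductSpace.qinner_smul_right u v q

theorem qinner_conj (u v : H) : qinner u v = star (qinner v u) :=
  QInnerProductSpace.qinner_conj u v

theorem qinner_self (u : H) : qinner u u = ((‖u‖ ^ 2 : ℝ) : ℍ[ℝ]) :=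
  QInnerProductSpace.qinner_self u

theorem qinner_add_left (u v w : H) : qinner (u + v) w = qinner u w + qinner v w := by
  rw [qinner_conj, qinner_add_right, star_add, ← qinner_conj, ← qinner_conj]

theorem qinner_smul_left (u v : H) (q : ℍ[ℝ]) :
    qinner (MulOpposite.op q • u) v = star q * qinner u v := by
  rw [qinner_conj, qinner_smul_right, star_mul, ← qinner_conj]

theorem qinner_neg_right (u v : H) : qinner u (-v) = -qinner u v := by
  have h : (-v : H) = MulOpposite.op (-1 : ℍ[ℝ]) • v := by simp
  rw [h, qinner_smul_right]; simp

theorem qinner_neg_left (u v : H) : qinner (-u) v = -qinner u v := by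
  rw [qinner_conj, qinner_neg_right, star_neg, ← qinner_conj]

theorem qinner_sub_right (u v w : H) : qinner u (v - w) = qinner u v - qinner u w := by
  rw [sub_eq_add_neg, qinner_add_right, qinner_neg_right, sub_eq_add_neg]

theorem qinner_sub_left (u v w : H) : qinner (u - v) w = qinner u w - qinner v w := by
  rw [sub_eq_add_neg, qinner_add_left, qinner_neg_left, sub_eq_add_neg]

theorem qinner_zero_right (u : H) : qinner u (0 : H) = 0 := by
  have h := qinner_sub_right u 0 0
  simpa using h

theorem qinner_zero_left (u : H) : qinner (0 : H) u = 0 := by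
  rw [qinner_conj, qinner_zero_right, star_zero]

theorem re_qinner_eq (u v : H) : (qinner u v).re = (‖u + v‖ ^ 2 - ‖u - v‖ ^ 2) / 4 := by
  have h1 : (qinner (u + v) (u + v)).re = ‖u + v‖ ^ 2 := by rw [qinner_self, Quaternion.re_coe]
  have h2 : (qinner (u - v) (u - v)).re = ‖u - v‖ ^ 2 := by rw [qinner_self, Quaternion.re_coe]
  have h3 : (qinner v u).re = (qinner u v).re := by rw [qinner_conj v u]; simp
  rw [← h1, ← h2]
  simp only [qinner_add_left, qinner_add_right, qinner_sub_left, qinner_sub_right,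
    Quaternion.re_add, Quaternion.re_sub, h3]
  ring

theorem continuous_re_qinner (u : H) : Continuous fun v : H => (qinner u v).re := by
  simp only [re_qinner_eq]
  fun_prop

theorem norm_qsmul (c : ℍ[ℝ]ᵐᵒᵖ) (u : H) : ‖c • u‖ = ‖c.unop‖ * ‖u‖ := by
  have h : ((‖c • u‖ ^ 2 : ℝ) : ℍ[ℝ]) = (((‖c.unop‖ * ‖u‖) ^ 2 : ℝ) : ℍ[ℝ]) := by
    rw [← qinner_self, ← MulOpposite.op_unop c, qinner_smul_left, qinner_smul_right, qinner_self,
      Quaternion.coe_commutes, ← mul_assoc, Quaternion.star_mul_self,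
      Quaternion.normSq_eq_norm_mul_self, ← Quaternion.coe_mul]
    congr 1
    simp only [MulOpposite.unop_op]
    ring
  exact (sq_eq_sq₀ (norm_nonneg _) (by positivity)).mp (Quaternion.coe_injective h)

theorem continuous_qsmul (c : ℍ[ℝ]ᵐᵒᵖ) : Continuous fun u : H => c • u := by
  let φ : H →+ H := DistribSMul.toAddMonoidHom H c
  exact AddMonoidHomClass.continuous_of_bound φ ‖c.unop‖ fun u => (norm_qsmul c u).le

/-- A Hilbert basis: an orthonormal set with trivial orthogonal complement. -/
structure IsHilbertBasis (N : Set H) : Prop where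
  norm_eq_one : ∀ z ∈ N, ‖z‖ = 1
  orthogonal : ∀ z ∈ N, ∀ z' ∈ N, z ≠ z' → qinner z z' = 0
  eq_zero_of_orthogonal : ∀ u : H, (∀ z ∈ N, qinner u z = 0) → u = 0

/-- `L` is the left scalar multiplication `q ↦ L_q` induced by some Hilbert basis `N`, that is
`L_q u = ∑_{z ∈ N} z q ⟨z | u⟩`. -/
def IsLeftScalarMul (L : ℍ[ℝ] → (H →L[ℍ[ℝ]ᵐᵒᵖ] H)) : Prop :=
  ∃ N : Set H, IsHilbertBasis N ∧ ∀ (q : ℍ[ℝ]) (u : H),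
    HasSum (fun z : N => MulOpposite.op (q * qinner (z : H) u) • (z : H)) (L q u)

/-! ### Operators with a domain -/

/-- The composition `T S`, with domain `{u ∈ D(S) | S u ∈ D(T)}`. -/
def opComp (T S : H →ₗ.[ℍ[ℝ]ᵐᵒᵖ] H) : H →ₗ.[ℍ[ℝ]ᵐᵒᵖ] H :=
  T.comp (S.domRestrict ((T.domain.comap S.toFun).map S.domain.subtype)) (by
    rintro ⟨x, hx⟩
    obtain ⟨y, hy, hyx⟩ := hx.1
    subst hyx
    exact hy)

/-- The graph of the adjoint: the pairs `(u, w)` with `⟨w | v⟩ = ⟨u | T v⟩` for all `v ∈ D(T)`. -/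
def adjointGraph (T : H →ₗ.[ℍ[ℝ]ᵐᵒᵖ] H) : Submodule ℍ[ℝ]ᵐᵒᵖ (H × H) where
  carrier := {p | ∀ v : T.domain, qinner p.2 (v : H) = qinner p.1 (T v)}
  add_mem' := by
    intro a b ha hb v
    simp only [Prod.fst_add, Prod.snd_add, qinner_add_left, ha v, hb v]
  zero_mem' := by
    intro v
    simp only [Prod.fst_zero, Prod.snd_zero, qinner_zero_left]
  smul_mem' := by
    intro c a ha v
    induction c using MulOpposite.rec' with
    | h q => simp only [Prod.smul_fst, Prod.smul_snd, qinner_smul_left, ha v]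

/-- The adjoint `T*` of a densely defined operator `T`. -/
def opAdjoint (T : H →ₗ.[ℍ[ℝ]ᵐᵒᵖ] H) : H →ₗ.[ℍ[ℝ]ᵐᵒᵖ] H := (adjointGraph T).toLinearPMap

/-- An operator is closed if its graph is closed in `H × H`. -/
def OpIsClosed (T : H →ₗ.[ℍ[ℝ]ᵐᵒᵖ] H) : Prop := IsClosed (T.graph : Set (H × H))

/-- A (densely defined) operator is normal if `T T* = T* T`. -/
def OpIsNormal (T : H →ₗ.[ℍ[ℝ]ᵐᵒᵖ] H) : Prop := opComp T (opAdjoint T) = opComp (opAdjoint T) T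

end Hilbert

/-! ### Intertwining quaternionic projection-valued measures -/

/-- The sphere of imaginary units of the quaternions. -/
def imaginaryUnits : Set ℍ[ℝ] := {q | q * q = -1}

/-- The closed half plane `{α + ι β | α, β ∈ ℝ, β ≥ 0}`; as a type it carries the topology and the
Borel `σ`-algebra induced by the quaternions. -/
def halfPlane (ι : ℍ[ℝ]) : Set ℍ[ℝ] := {q | ∃ α β : ℝ, 0 ≤ β ∧ q = (α : ℍ[ℝ]) + ι * (β : ℍ[ℝ])}

/-- An intertwining quaternionic projection-valued measure `(P, L)` over the half plane of `ι`
in `H`. Only the values of `P` on Borel sets matter. -/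
structure IqPVM (ι : ℍ[ℝ]) (H : Type*) [NormedAddCommGroup H] [Module ℍ[ℝ]ᵐᵒᵖ H]
    [QInnerProductSpace H] where
  P : Set (halfPlane ι) → (H →L[ℍ[ℝ]ᵐᵒᵖ] H)
  L : ℍ[ℝ] → (H →L[ℍ[ℝ]ᵐᵒᵖ] H)
  P_univ : P Set.univ = ContinuousLinearMap.id ℍ[ℝ]ᵐᵒᵖ H
  P_inter : ∀ E F, MeasurableSet E → MeasurableSet F → (P E).comp (P F) = P (E ∩ F)
  P_iUnion : ∀ E : ℕ → Set (halfPlane ι), (∀ n, MeasurableSet (E n)) →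
    Pairwise (Function.onFun Disjoint E) → ∀ u : H, HasSum (fun n => P (E n) u) (P (⋃ n, E n) u)
  P_nonneg : ∀ E, MeasurableSet E → ∀ u : H,
    ∃ r : ℝ, 0 ≤ r ∧ qinner u (P E u) = ((r : ℝ) : ℍ[ℝ])
  isLeftScalarMul : IsLeftScalarMul L
  P_comm : ∀ E, MeasurableSet E → ∀ q, (P E).comp (L q) = (L q).comp (P E)

namespace IqPVM

variable {ι : ℍ[ℝ]} {H : Type*} [NormedAddCommGroup H] [Module ℍ[ℝ]ᵐᵒᵖ H] [QInnerProductSpace H]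
  (PL : IqPVM ι H)

theorem re_nonneg {E : Set (halfPlane ι)} (hE : MeasurableSet E) (u : H) :
    0 ≤ (qinner u (PL.P E u)).re := by
  obtain ⟨r, hr, h⟩ := PL.P_nonneg E hE u
  rw [h]; simpa using hr

theorem P_empty_apply (u : H) : PL.P ∅ u = 0 := by
  have h := PL.P_iUnion (fun _ => ∅) (fun _ => MeasurableSet.empty)
    (fun i j _ => by simp [Function.onFun]) u
  exact tendsto_nhds_unique tendsto_const_nhds h.summable.tendsto_atTop_zero

/-- The finite Borel measure `μ_u(E) = ⟨u | P(E) u⟩`. -/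
def measure (u : H) : Measure (halfPlane ι) :=
  Measure.ofMeasurable (fun E _ => ENNReal.ofReal (qinner u (PL.P E u)).re)
    (by simp [P_empty_apply, qinner_zero_right])
    (by
      intro E hE hd
      have h := PL.P_iUnion E hE hd u
      let φ : H →+ ℝ := AddMonoidHom.mk' (fun v : H => (qinner u v).re)
        (fun v w => by simp [qinner_add_right])
      have h' : HasSum (fun n => (qinner u (PL.P (E n) u)).re)
          (qinner u (PL.P (⋃ n, E n) u)).re := h.map φ (continuous_re_qinner u)
      rw [← h'.tsum_eq]
      exact ENNReal.ofReal_tsum_of_nonneg (fun n => PL.re_nonneg (hE n) u) h'.summable)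

theorem measure_apply (u : H) {E : Set (halfPlane ι)} (hE : MeasurableSet E) :
    PL.measure u E = ENNReal.ofReal (qinner u (PL.P E u)).re :=
  Measure.ofMeasurable_apply E hE

theorem measure_add_le (u v : H) :
    PL.measure (u + v) ≤ (2 : ℝ≥0∞) • (PL.measure u + PL.measure v) := by
  refine Measure.le_iff.mpr fun E hE => ?_
  simp only [Measure.smul_apply, Measure.add_apply, PL.measure_apply _ hE, smul_eq_mul]
  rw [← ENNReal.ofReal_add (PL.re_nonneg hE u) (PL.re_nonneg hE v),
    ← ENNReal.ofReal_ofNat, ← ENNReal.ofReal_mul (by norm_num)]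
  refine ENNReal.ofReal_le_ofReal ?_
  have h := PL.re_nonneg hE (u - v)
  simp only [map_sub, map_add, qinner_add_left, qinner_add_right, qinner_sub_left,
    qinner_sub_right, Quaternion.re_add, Quaternion.re_sub] at h ⊢
  linarith

theorem measure_smul (u : H) (q : ℍ[ℝ]) :
    PL.measure (MulOpposite.op q • u) = ENNReal.ofReal (‖q‖ ^ 2) • PL.measure u := by
  refine Measure.ext fun E hE => ?_
  simp only [Measure.smul_apply, PL.measure_apply _ hE, smul_eq_mul]
  rw [← ENNReal.ofReal_mul (by positivity)]
  congr 1
  obtain ⟨r, -, h⟩ := PL.P_nonneg E hE u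
  rw [map_smul, qinner_smul_left, qinner_smul_right, h, Quaternion.coe_commutes,
    ← mul_assoc, Quaternion.star_mul_self, Quaternion.normSq_eq_norm_mul_self]
  simp [pow_two]

/-- The domain `D_f = {u | f ∈ L²(μ_u)}`, a right subspace of `H`. -/
def squareDomain (f : halfPlane ι → ℍ[ℝ]) : Submodule ℍ[ℝ]ᵐᵒᵖ H where
  carrier := {u | MemLp f 2 (PL.measure u)}
  add_mem' := by
    intro u v hu hv
    refine MemLp.of_measure_le_smul (c := 2) (by simp) (PL.measure_add_le u v) ?_
    refine ⟨aestronglyMeasurable_add_measure_iff.mpr ⟨hu.1, hv.1⟩, ?_⟩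
    have h2 : (2 : ℝ≥0∞) ≠ 0 := by norm_num
    have h2' : (2 : ℝ≥0∞) ≠ ∞ := by norm_num
    rw [eLpNorm_lt_top_iff_lintegral_rpow_enorm_lt_top h2 h2', lintegral_add_measure]
    exact ENNReal.add_lt_top.mpr
      ⟨(eLpNorm_lt_top_iff_lintegral_rpow_enorm_lt_top h2 h2').mp hu.2,
        (eLpNorm_lt_top_iff_lintegral_rpow_enorm_lt_top h2 h2').mp hv.2⟩
  zero_mem' := by
    have h : PL.measure (0 : H) = 0 := Measure.ext fun E hE => by
      simp [PL.measure_apply _ hE, qinner_zero_left]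
    simp [h]
  smul_mem' := by
    intro c u hu
    induction c using MulOpposite.rec' with
    | h q =>
      change MemLp f 2 (PL.measure (MulOpposite.op q • u))
      rw [PL.measure_smul]
      exact MemLp.smul_measure hu ENNReal.ofReal_ne_top

/-- The norm `‖f‖_∞^(P) ∈ [0, ∞]`. -/
def essNorm (f : halfPlane ι → ℍ[ℝ]) : ℝ≥0∞ :=
  ⨅ (k : ℝ≥0) (_ : PL.P {q | (k : ℝ) < ‖f q‖} = 0), (k : ℝ≥0∞)

/-- `f` is `P`-essentially bounded. -/
def IsEssBounded (f : halfPlane ι → ℍ[ℝ]) : Prop := PL.essNorm f < ∞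

/-! ### The integral -/

/-- The integral `∑_ℓ L_{S_ℓ} P(E_ℓ)` of the simple function `s = ∑_ℓ S_ℓ χ_{E_ℓ}`. -/
def integralSimple (s : SimpleFunc (halfPlane ι) ℍ[ℝ]) : H →L[ℍ[ℝ]ᵐᵒᵖ] H :=
  ∑ x ∈ s.range, (PL.L x).comp (PL.P (s ⁻¹' {x}))

/-- `T` is the limit in operator norm of the integrals of `s n`, for every sequence `s` of simple
functions that converges uniformly to `φ`, and there is such a sequence. -/
def IsBoundedIntegral (φ : halfPlane ι → ℍ[ℝ]) (T : H →L[ℍ[ℝ]ᵐᵒᵖ] H) : Prop :=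
  (∃ s : ℕ → SimpleFunc (halfPlane ι) ℍ[ℝ], TendstoUniformly (fun n => ⇑(s n)) φ atTop) ∧
  ∀ s : ℕ → SimpleFunc (halfPlane ι) ℍ[ℝ], TendstoUniformly (fun n => ⇑(s n)) φ atTop →
    ∀ ε : ℝ, 0 < ε → ∀ᶠ n in atTop, ∀ u : H, ‖PL.integralSimple (s n) u - T u‖ ≤ ε * ‖u‖

open scoped Classical in
/-- The integral of a bounded measurable function `φ`. -/
def integralBounded (φ : halfPlane ι → ℍ[ℝ]) : H →L[ℍ[ℝ]ᵐᵒᵖ] H :=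
  if h : ∃ T, PL.IsBoundedIntegral φ T then h.choose else 0

open scoped Classical in
/-- The truncation `f_n`, equal to `f` where `|f| ≤ n` and to `0` elsewhere. -/
def truncation (f : halfPlane ι → ℍ[ℝ]) (n : ℕ) : halfPlane ι → ℍ[ℝ] :=
  fun q => if ‖f q‖ ≤ (n : ℝ) then f q else 0

/-- The graph of the integral of `f`: the pairs `(u, w)` with `u ∈ D_f` and
`w = lim_n (∫ f_n dPL) u`. -/
def integralGraph (f : halfPlane ι → ℍ[ℝ]) : Submodule ℍ[ℝ]ᵐᵒᵖ (H × H) where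
  carrier := {p | p.1 ∈ PL.squareDomain f ∧
    Tendsto (fun n : ℕ => PL.integralBounded (truncation f n) p.1) atTop (𝓝 p.2)}
  add_mem' := by
    intro a b ha hb
    refine ⟨add_mem ha.1 hb.1, ?_⟩
    simpa only [Prod.fst_add, Prod.snd_add, map_add] using ha.2.add hb.2
  zero_mem' := by
    refine ⟨zero_mem _, ?_⟩
    simp only [Prod.fst_zero, Prod.snd_zero, map_zero]
    exact tendsto_const_nhds
  smul_mem' := by
    intro c a ha
    refine ⟨Submodule.smul_mem _ c ha.1, ?_⟩
    simp only [Prod.smul_fst, Prod.smul_snd, map_smul]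
    exact ((continuous_qsmul c).tendsto a.2).comp ha.2

/-- The operator `∫ f dPL`, which sends `u ∈ D_f` to `lim_n (∫ f_n dPL) u`. -/
def integral (f : halfPlane ι → ℍ[ℝ]) : H →ₗ.[ℍ[ℝ]ᵐᵒᵖ] H := (PL.integralGraph f).toLinearPMap

end IqPVM

end

end QuaternionicIntegral

open QuaternionicIntegral

namespace QuaternionicIntegral

section Hilbert

variable {H : Type*} [NormedAddCommGroup H] [Module ℍ[ℝ]ᵐᵒᵖ H] [QInnerProductSpace H]

theorem _root_.Quaternion.exists_basis_units : ∃ i j k : ℍ[ℝ],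
    (i.re = 0 ∧ i.imI = 1 ∧ i.imJ = 0 ∧ i.imK = 0) ∧
    (j.re = 0 ∧ j.imI = 0 ∧ j.imJ = 1 ∧ j.imK = 0) ∧
    (k.re = 0 ∧ k.imI = 0 ∧ k.imJ = 0 ∧ k.imK = 1) :=
  ⟨⟨0, 1, 0, 0⟩, ⟨0, 0, 1, 0⟩, ⟨0, 0, 0, 1⟩, by simp⟩

theorem continuous_qinner_right (u : H) : Continuous fun v : H => qinner u v := by
  have key : ∀ q : ℍ[ℝ], Continuous fun v : H => (qinner u v * q).re := fun q => by
    simp only [← qinner_smul_right]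
    exact (continuous_re_qinner u).comp (continuous_qsmul _)
  obtain ⟨i, j, k, hi, hj, hk⟩ := Quaternion.exists_basis_units
  have h : ∀ x : ℍ[ℝ], x = (x.re : ℍ[ℝ]) - ((x * i).re : ℍ[ℝ]) * i - ((x * j).re : ℍ[ℝ]) * j
      - ((x * k).re : ℍ[ℝ]) * k := fun x => by
    ext <;> simp [hi, hj, hk]
  have h' : (fun v : H => qinner u v) = fun v => ((qinner u v).re : ℍ[ℝ])
      - ((qinner u v * i).re : ℍ[ℝ]) * i - ((qinner u v * j).re : ℍ[ℝ]) * j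
      - ((qinner u v * k).re : ℍ[ℝ]) * k := funext fun v => h _
  rw [h']
  have hc : Continuous fun r : ℝ => (r : ℍ[ℝ]) := Quaternion.continuous_coe
  exact (((hc.comp (continuous_re_qinner u)).sub ((hc.comp (key i)).mul continuous_const)).sub
    ((hc.comp (key j)).mul continuous_const)).sub ((hc.comp (key k)).mul continuous_const)

theorem continuous_qinner_left (v : H) : Continuous fun u : H => qinner u v := by
  simp only [qinner_conj _ v]
  exact (continuous_qinner_right v).star

/-- The additive map `v ↦ ⟨u | v⟩`. -/
def qinnerHom (u : H) : H →+ ℍ[ℝ] := AddMonoidHom.mk' (qinner u) (qinner_add_right u)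

theorem qinner_sum_right {α : Type*} (s : Finset α) (u : H) (w : α → H) :
    qinner u (∑ x ∈ s, w x) = ∑ x ∈ s, qinner u (w x) :=
  map_sum (qinnerHom u) w s

theorem qinner_sum_left {α : Type*} (s : Finset α) (u : H) (w : α → H) :
    qinner (∑ x ∈ s, w x) u = ∑ x ∈ s, qinner (w x) u := by
  rw [qinner_conj, qinner_sum_right, star_sum]
  simp only [← qinner_conj]

theorem ext_qinner_left {u v : H} (h : ∀ w, qinner u w = qinner v w) : u = v := by
  have h1 := h (u - v)
  rw [← sub_eq_zero, ← qinner_sub_left, qinner_self, ← Quaternion.coe_zero] at h1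
  have h2 := Quaternion.coe_injective h1
  exact sub_eq_zero.mp (norm_eq_zero.mp (pow_eq_zero_iff two_ne_zero |>.mp h2))

theorem norm_sq_eq_re (u : H) : ‖u‖ ^ 2 = (qinner u u).re := by
  rw [qinner_self, Quaternion.re_coe]

/-- A bounded operator whose diagonal values are real is symmetric. -/
theorem qinner_symm_of_real_diag (T : H →L[ℍ[ℝ]ᵐᵒᵖ] H)
    (hT : ∀ u, ∃ r : ℝ, qinner u (T u) = (r : ℍ[ℝ])) (u v : H) :
    qinner (T u) v = qinner u (T v) := by
  let B : H → H → ℍ[ℝ] := fun u v => qinner u (T v) - qinner (T u) v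
  have hdiag : ∀ u, B u u = 0 := fun u => by
    obtain ⟨r, hr⟩ := hT u
    simp only [B]
    rw [qinner_conj (T u) u, hr]
    simp
  have hanti : ∀ u v, B u v = -B v u := fun u v => by
    have h := hdiag (u + v)
    have hu := hdiag u
    have hv := hdiag v
    simp only [B, map_add, qinner_add_left, qinner_add_right] at h hu hv ⊢
    refine eq_neg_of_add_eq_zero_left ?_
    calc _ = (qinner u (T u) + qinner v (T u) + (qinner u (T v) + qinner v (T v)) -
          (qinner (T u) u + qinner (T v) u + (qinner (T u) v + qinner (T v) v))) -
          (qinner u (T u) - qinner (T u) u) - (qinner v (T v) - qinner (T v) v) := by abel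
      _ = 0 := by rw [hu, hv, sub_zero, sub_zero, ← h]
  have hq : ∀ q : ℍ[ℝ], star q * B u v = B u v * q := fun q => by
    have h1 : B (MulOpposite.op q • u) v = star q * B u v := by
      simp only [B, map_smul, qinner_smul_left, mul_sub]
    have h2 : B v (MulOpposite.op q • u) = B v u * q := by
      simp only [B, map_smul, qinner_smul_right, sub_mul]
    rw [← h1, hanti, h2, hanti v u]
    simp
  have h0 : B u v = 0 := by
    obtain ⟨i, j, k, hi, hj, hk⟩ := Quaternion.exists_basis_units
    have h1 := hq i
    have h2 := hq j
    have h3 := hq k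
    rw [Quaternion.ext_iff] at h1 h2 h3
    simp only [Quaternion.re_mul, Quaternion.imI_mul, Quaternion.imJ_mul, Quaternion.imK_mul,
      Quaternion.re_star, Quaternion.imI_star, Quaternion.imJ_star, Quaternion.imK_star,
      hi, hj, hk] at h1 h2 h3
    ext <;> simp only [Quaternion.re_zero, Quaternion.imI_zero, Quaternion.imJ_zero,
      Quaternion.imK_zero] <;> linarith [h1.1, h1.2.1, h2.1, h3.1]
  exact (sub_eq_zero.mp h0).symm

end Hilbert

section LeftScalarMul

variable {H : Type*} [NormedAddCommGroup H] [Module ℍ[ℝ]ᵐᵒᵖ H] [QInnerProductSpace H]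
  {L : ℍ[ℝ] → (H →L[ℍ[ℝ]ᵐᵒᵖ] H)}

theorem IsHilbertBasis.ext {N : Set H} (hN : IsHilbertBasis N) {u v : H}
    (h : ∀ z ∈ N, qinner z u = qinner z v) : u = v := by
  refine sub_eq_zero.mp (hN.eq_zero_of_orthogonal _ fun z hz => ?_)
  rw [qinner_conj, qinner_sub_right, h z hz, sub_self, star_zero]

theorem IsLeftScalarMul.exists_basis (hL : IsLeftScalarMul L) :
    ∃ N : Set H, IsHilbertBasis N ∧ ∀ q u, ∀ z ∈ N, qinner z (L q u) = q * qinner z u := by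
  obtain ⟨N, hN, h⟩ := hL
  refine ⟨N, hN, fun q u z hz => ?_⟩
  have h1 := (h q u).map (qinnerHom z) (continuous_qinner_right z)
  refine h1.unique ?_
  have h2 : q * qinner z u = (qinnerHom z ∘ fun z' : N =>
      MulOpposite.op (q * qinner (z' : H) u) • (z' : H)) ⟨z, hz⟩ := by
    simp only [qinnerHom, Function.comp_apply, AddMonoidHom.mk'_apply, qinner_smul_right,
      qinner_self, hN.norm_eq_one z hz]
    simp
  rw [h2]
  refine hasSum_single _ fun z' hz' => ?_
  have : qinner z (z' : H) = 0 :=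
    hN.orthogonal z hz z' z'.2 fun he => hz' (Subtype.ext he.symm)
  simp only [qinnerHom, Function.comp_apply, AddMonoidHom.mk'_apply, qinner_smul_right, this,
    zero_mul]

theorem IsLeftScalarMul.mul (hL : IsLeftScalarMul L) (p q : ℍ[ℝ]) (u : H) :
    L (p * q) u = L p (L q u) := by
  obtain ⟨N, hN, h⟩ := hL.exists_basis
  exact hN.ext fun z hz => by simp only [h _ _ z hz, mul_assoc]

theorem IsLeftScalarMul.add (hL : IsLeftScalarMul L) (p q : ℍ[ℝ]) (u : H) :
    L (p + q) u = L p u + L q u := by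
  obtain ⟨N, hN, h⟩ := hL.exists_basis
  exact hN.ext fun z hz => by simp only [qinner_add_right, h _ _ z hz, add_mul]

theorem IsLeftScalarMul.coe (hL : IsLeftScalarMul L) (r : ℝ) (u : H) :
    L (r : ℍ[ℝ]) u = MulOpposite.op (r : ℍ[ℝ]) • u := by
  obtain ⟨N, hN, h⟩ := hL.exists_basis
  exact hN.ext fun z hz => by rw [h _ _ z hz, qinner_smul_right, Quaternion.coe_commutes]

theorem IsLeftScalarMul.qinner_left (hL : IsLeftScalarMul L) (q : ℍ[ℝ]) (u v : H) :
    qinner (L q u) v = qinner u (L (star q) v) := by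
  obtain ⟨N, -, h⟩ := hL
  have h1 := ((h q u).map (qinnerHom v) (continuous_qinner_right v)).star
  have h2 := (h (star q) v).map (qinnerHom u) (continuous_qinner_right u)
  rw [qinner_conj]
  refine h1.unique (h2.congr_fun ?_)
  intro z
  simp only [qinnerHom, Function.comp_apply, AddMonoidHom.mk'_apply, qinner_smul_right, star_mul,
    ← qinner_conj, mul_assoc]

end LeftScalarMul

namespace IqPVM

variable {ι : ℍ[ℝ]} {H : Type*} [NormedAddCommGroup H] [Module ℍ[ℝ]ᵐᵒᵖ H] [QInnerProductSpace H]
  (PL : IqPVM ι H)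

theorem P_symm {E : Set (halfPlane ι)} (hE : MeasurableSet E) (u v : H) :
    qinner (PL.P E u) v = qinner u (PL.P E v) :=
  qinner_symm_of_real_diag _ (fun u => (PL.P_nonneg E hE u).imp fun _ h => h.2) u v

theorem P_P_apply {E F : Set (halfPlane ι)} (hE : MeasurableSet E) (hF : MeasurableSet F) (u : H) :
    PL.P E (PL.P F u) = PL.P (E ∩ F) u := by
  rw [← PL.P_inter E F hE hF]; rfl

theorem P_L_apply {E : Set (halfPlane ι)} (hE : MeasurableSet E) (q : ℍ[ℝ]) (u : H) :
    PL.P E (PL.L q u) = PL.L q (PL.P E u) :=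
  DFunLike.congr_fun (PL.P_comm E hE q) u

theorem qinner_P_self {E : Set (halfPlane ι)} (hE : MeasurableSet E) (u : H) :
    (qinner u (PL.P E u)).re = ‖PL.P E u‖ ^ 2 := by
  rw [norm_sq_eq_re, PL.P_symm hE, PL.P_P_apply hE hE, Set.inter_self]

theorem measure_eq_enorm_sq (u : H) {E : Set (halfPlane ι)} (hE : MeasurableSet E) :
    PL.measure u E = ‖PL.P E u‖ₑ ^ 2 := by
  rw [PL.measure_apply u hE, PL.qinner_P_self hE, ← ofReal_norm, ENNReal.ofReal_pow (norm_nonneg _)]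

theorem P_univ_apply (u : H) : PL.P Set.univ u = u := by
  rw [PL.P_univ]; rfl

theorem measure_univ (u : H) : PL.measure u Set.univ = ‖u‖ₑ ^ 2 := by
  rw [PL.measure_eq_enorm_sq u MeasurableSet.univ, PL.P_univ_apply]

instance isFiniteMeasure_measure (u : H) : IsFiniteMeasure (PL.measure u) :=
  ⟨by rw [PL.measure_univ]; simp⟩

theorem P_biUnion {α : Type*} [DecidableEq α] (t : Finset α) (A : α → Set (halfPlane ι))
    (hA : ∀ i, MeasurableSet (A i)) (hd : Pairwise (Function.onFun Disjoint A)) (u : H) :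
    PL.P (⋃ i ∈ t, A i) u = ∑ i ∈ t, PL.P (A i) u := by
  induction t using Finset.induction_on with
  | empty => simp [P_empty_apply]
  | insert a t ha ih =>
    rw [Finset.sum_insert ha, ← ih, Finset.set_biUnion_insert]
    let B : ℕ → Set (halfPlane ι) := fun n => if n = 0 then A a else if n = 1 then
      ⋃ i ∈ t, A i else ∅
    have hB : ⋃ n, B n = A a ∪ ⋃ i ∈ t, A i := by
      ext x
      simp only [Set.mem_iUnion, Set.mem_union]
      constructor
      · rintro ⟨n, hn⟩
        by_cases h0 : n = 0
        · left; simpa [B, h0] using hn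
        · by_cases h1 : n = 1
          · right; simpa [B, h1] using hn
          · simp [B, h0, h1] at hn
      · rintro (h | h)
        · exact ⟨0, by simpa [B] using h⟩
        · exact ⟨1, by simpa [B] using h⟩
    have hdis : Disjoint (A a) (⋃ i ∈ t, A i) := by
      refine Set.disjoint_iUnion₂_right.mpr fun i hi => hd ?_
      rintro rfl
      exact ha hi
    have hs := PL.P_iUnion B (fun n => by
      simp only [B]
      split_ifs
      · exact hA a
      · exact Finset.measurableSet_biUnion t fun i _ => hA i
      · exact MeasurableSet.empty) (by
      intro m n hmn
      simp only [Function.onFun, B]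
      split_ifs <;> first | omega | simp_all [disjoint_comm]) u
    rw [hB] at hs
    refine hs.unique ?_
    have h2 : HasSum (fun n => PL.P (B n) u) (∑ n ∈ {0, 1}, PL.P (B n) u) :=
      hasSum_sum_of_ne_finset_zero
      (fun n hn => by
        simp only [Finset.mem_insert, Finset.mem_singleton, not_or] at hn
        simp [B, hn.1, hn.2, P_empty_apply])
    simpa [B] using h2

end IqPVM

end QuaternionicIntegral

namespace QuaternionicIntegral.IqPVM

variable {ι : ℍ[ℝ]} {H : Type*} [NormedAddCommGroup H] [Module ℍ[ℝ]ᵐᵒᵖ H] [QInnerProductSpace H]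
  (PL : IqPVM ι H)

/-! ### The integral of simple functions -/

theorem integralSimple_apply (s : SimpleFunc (halfPlane ι) ℍ[ℝ]) (u : H) :
    PL.integralSimple s u = ∑ x ∈ s.range, PL.L x (PL.P (s ⁻¹' {x}) u) := by
  simp [integralSimple]

theorem integralSimple_map {β : Type*} (r : SimpleFunc (halfPlane ι) β) (φ : β → ℍ[ℝ])
    (F : Finset β) (hF : r.range ⊆ F) (u : H) :
    PL.integralSimple (r.map φ) u = ∑ b ∈ F, PL.L (φ b) (PL.P (r ⁻¹' {b}) u) := by
  classical
  have hsub : ∑ b ∈ F, PL.L (φ b) (PL.P (r ⁻¹' {b}) u) =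
      ∑ b ∈ r.range, PL.L (φ b) (PL.P (r ⁻¹' {b}) u) := by
    refine (Finset.sum_subset hF fun b _ hb => ?_).symm
    have : r ⁻¹' {b} = ∅ := by
      rw [SimpleFunc.preimage_eq_empty_iff]; exact hb
    rw [this, P_empty_apply, map_zero]
  rw [hsub, integralSimple_apply, SimpleFunc.range_map]
  rw [← Finset.sum_fiberwise_of_maps_to (s := r.range) (t := r.range.image φ) (g := φ)
    fun b hb => Finset.mem_image_of_mem φ hb]
  refine Finset.sum_congr rfl fun y _ => ?_
  have hpre : (r.map φ) ⁻¹' {y} = ⋃ b ∈ r.range.filter (φ · = y), r ⁻¹' {b} := by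
    ext x
    simp only [SimpleFunc.coe_map, Set.mem_preimage, Function.comp_apply, Set.mem_singleton_iff,
      Set.mem_iUnion, Finset.mem_filter, exists_prop]
    exact ⟨fun h => ⟨r x, ⟨SimpleFunc.mem_range_self r x, h⟩, rfl⟩, fun ⟨b, hb, h⟩ => h ▸ hb.2⟩
  rw [hpre, PL.P_biUnion _ _ (fun b => r.measurableSet_preimage {b}), map_sum]
  · refine Finset.sum_congr rfl fun b hb => ?_
    rw [(Finset.mem_filter.mp hb).2]
  · intro b b' hbb'
    exact (Set.disjoint_singleton.mpr hbb').preimage r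

theorem integralSimple_add (s t : SimpleFunc (halfPlane ι) ℍ[ℝ]) (u : H) :
    PL.integralSimple (s + t) u = PL.integralSimple s u + PL.integralSimple t u := by
  have h1 := PL.integralSimple_map (s.pair t) (fun p => p.1 + p.2) _ subset_rfl u
  have h2 := PL.integralSimple_map (s.pair t) Prod.fst _ subset_rfl u
  have h3 := PL.integralSimple_map (s.pair t) Prod.snd _ subset_rfl u
  rw [SimpleFunc.map_fst_pair] at h2
  rw [SimpleFunc.map_snd_pair] at h3
  rw [h2, h3, ← Finset.sum_add_distrib, SimpleFunc.add_eq_map₂, h1]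
  exact Finset.sum_congr rfl fun p _ => PL.isLeftScalarMul.add _ _ _

theorem integralSimple_mul (s t : SimpleFunc (halfPlane ι) ℍ[ℝ]) (u : H) :
    PL.integralSimple (s * t) u = PL.integralSimple s (PL.integralSimple t u) := by
  have h1 := PL.integralSimple_map (s.pair t) (fun p => p.1 * p.2) (s.range ×ˢ t.range)
    (fun p hp => by
      obtain ⟨x, rfl⟩ := SimpleFunc.mem_range.mp hp
      exact Finset.mk_mem_product (SimpleFunc.mem_range_self s x) (SimpleFunc.mem_range_self t x)) u
  rw [SimpleFunc.mul_eq_map₂, h1, Finset.sum_product, integralSimple_apply]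
  refine Finset.sum_congr rfl fun x _ => ?_
  rw [integralSimple_apply, map_sum, map_sum]
  refine Finset.sum_congr rfl fun y _ => ?_
  rw [PL.isLeftScalarMul.mul, PL.P_L_apply (s.measurableSet_preimage _),
    PL.P_P_apply (s.measurableSet_preimage _) (t.measurableSet_preimage _),
    SimpleFunc.pair_preimage_singleton]

theorem integralSimple_star (s : SimpleFunc (halfPlane ι) ℍ[ℝ]) (u v : H) :
    qinner (PL.integralSimple s u) v = qinner u (PL.integralSimple (s.map star) v) := by
  rw [PL.integralSimple_map s star _ subset_rfl, integralSimple_apply, qinner_sum_left,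
    qinner_sum_right]
  refine Finset.sum_congr rfl fun x _ => ?_
  rw [PL.isLeftScalarMul.qinner_left, PL.P_symm (s.measurableSet_preimage _),
    PL.P_L_apply (s.measurableSet_preimage _)]

theorem enorm_integralSimple_sq (s : SimpleFunc (halfPlane ι) ℍ[ℝ]) (u : H) :
    ‖PL.integralSimple s u‖ₑ ^ 2 = ∫⁻ x, ‖s x‖ₑ ^ 2 ∂PL.measure u := by
  have h1 : ‖PL.integralSimple s u‖ ^ 2 =
      ∑ x ∈ s.range, ‖x‖ ^ 2 * (qinner u (PL.P (s ⁻¹' {x}) u)).re := by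
    have hm : s.map star * s = s.map fun x => ((‖x‖ ^ 2 : ℝ) : ℍ[ℝ]) := by
      ext1 x
      simp only [SimpleFunc.mul_apply, SimpleFunc.map_apply, Quaternion.star_mul_self,
        Quaternion.normSq_eq_norm_mul_self, pow_two]
    rw [norm_sq_eq_re, integralSimple_star, ← integralSimple_mul, hm,
      PL.integralSimple_map s _ _ subset_rfl, qinner_sum_right]
    refine (map_sum (QuaternionAlgebra.reₗ (-1 : ℝ) 0 (-1)) _ _).trans ?_
    refine Finset.sum_congr rfl fun x _ => ?_
    obtain ⟨r, -, hr⟩ := PL.P_nonneg _ (s.measurableSet_preimage {x}) u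
    rw [PL.isLeftScalarMul.coe, qinner_smul_right, hr, ← Quaternion.coe_mul,
      Quaternion.re_coe, mul_comm]
    rfl
  have h2 : ∫⁻ x, ‖s x‖ₑ ^ 2 ∂PL.measure u = (s.map fun x => ‖x‖ₑ ^ 2).lintegral (PL.measure u) := by
    rw [← SimpleFunc.lintegral_eq_lintegral]
    simp only [SimpleFunc.map_apply]
  rw [h2, SimpleFunc.map_lintegral, ← ofReal_norm, ← ENNReal.ofReal_pow (norm_nonneg _), h1,
    ENNReal.ofReal_sum_of_nonneg fun x _ =>
      mul_nonneg (by positivity) (PL.re_nonneg (s.measurableSet_preimage _) u)]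
  refine Finset.sum_congr rfl fun x _ => ?_
  rw [ENNReal.ofReal_mul (by positivity), PL.measure_apply u (s.measurableSet_preimage _),
    ENNReal.ofReal_pow (norm_nonneg _), ofReal_norm]

theorem eLpNorm_two_sq {E α : Type*} [NormedAddCommGroup E] [MeasurableSpace α] (f : α → E)
    (μ : Measure α) :
    eLpNorm f 2 μ ^ 2 = ∫⁻ x, ‖f x‖ₑ ^ 2 ∂μ := by
  rw [eLpNorm_eq_lintegral_rpow_enorm_toReal (by norm_num) (by norm_num), ← ENNReal.rpow_natCast,
    ← ENNReal.rpow_mul]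
  simp

theorem eq_of_sq_eq_sq {a b : ℝ≥0∞} (h : a ^ 2 = b ^ 2) : a = b :=
  (ENNReal.pow_right_strictMono two_ne_zero).injective h

theorem enorm_integralSimple (s : SimpleFunc (halfPlane ι) ℍ[ℝ]) (u : H) :
    ‖PL.integralSimple s u‖ₑ = eLpNorm s 2 (PL.measure u) :=
  eq_of_sq_eq_sq (by rw [enorm_integralSimple_sq, eLpNorm_two_sq])

theorem integralSimple_neg (s : SimpleFunc (halfPlane ι) ℍ[ℝ]) (u : H) :
    PL.integralSimple (-s) u = -PL.integralSimple s u := by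
  refine eq_neg_of_add_eq_zero_left ?_
  rw [← integralSimple_add, neg_add_cancel, ← enorm_eq_zero, enorm_integralSimple]
  simp

theorem integralSimple_sub (s t : SimpleFunc (halfPlane ι) ℍ[ℝ]) (u : H) :
    PL.integralSimple (s - t) u = PL.integralSimple s u - PL.integralSimple t u := by
  rw [sub_eq_add_neg, integralSimple_add, integralSimple_neg, sub_eq_add_neg]

open scoped Classical in
/-- The integral of an indicator function is the corresponding projection. -/
theorem integralSimple_indicator {E : Set (halfPlane ι)} (hE : MeasurableSet E) (u : H) :
    PL.integralSimple (SimpleFunc.piecewise E hE (SimpleFunc.const _ 1) (SimpleFunc.const _ 0)) u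
      = PL.P E u := by
  set s := SimpleFunc.piecewise E hE (SimpleFunc.const _ (1 : ℍ[ℝ])) (SimpleFunc.const _ 0) with hs
  have h0 : ∀ v, PL.L 0 v = 0 := fun v => by simpa using PL.isLeftScalarMul.coe 0 v
  have h1 : ∀ v, PL.L 1 v = v := fun v => by simpa using PL.isLeftScalarMul.coe 1 v
  have h := PL.integralSimple_map s id {0, 1} (fun x hx => by
    obtain ⟨y, rfl⟩ := SimpleFunc.mem_range.mp hx
    by_cases hy : y ∈ E <;> simp [hs, hy]) u
  rw [Finset.sum_pair zero_ne_one, id, id, h0, h1, zero_add] at h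
  refine h.trans ?_
  congr 2
  ext y
  by_cases hy : y ∈ E <;> simp [hs, hy]

end QuaternionicIntegral.IqPVM

namespace QuaternionicIntegral.IqPVM

variable {ι : ℍ[ℝ]} {H : Type*} [NormedAddCommGroup H] [Module ℍ[ℝ]ᵐᵒᵖ H] [QInnerProductSpace H]
  (PL : IqPVM ι H)

/-! ### The strong integral at a vector -/

theorem mem_squareDomain {f : halfPlane ι → ℍ[ℝ]} {u : H} :
    u ∈ PL.squareDomain f ↔ MemLp f 2 (PL.measure u) := Iff.rfl

theorem mem_squareDomain_iff_lt_top {f : halfPlane ι → ℍ[ℝ]} (hf : Measurable f) {u : H} :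
    u ∈ PL.squareDomain f ↔ eLpNorm f 2 (PL.measure u) < ∞ :=
  ⟨fun h => h.2, fun h => ⟨hf.aestronglyMeasurable, h⟩⟩

/-- `w` is the limit of the integrals at `u` of all sequences of simple functions that converge to
`f` in `L²(μ_u)`. -/
def HasIntegral (f : halfPlane ι → ℍ[ℝ]) (u w : H) : Prop :=
  ∀ s : ℕ → SimpleFunc (halfPlane ι) ℍ[ℝ],
    Tendsto (fun n => eLpNorm (⇑(s n) - f) 2 (PL.measure u)) atTop (𝓝 0) →
      Tendsto (fun n => PL.integralSimple (s n) u) atTop (𝓝 w)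

open scoped Classical in
/-- The value at `u ∈ D_f` of the integral of `f`, as a limit in `L²(μ_u)`. -/
noncomputable def strongIntegral (f : halfPlane ι → ℍ[ℝ]) (u : H) : H :=
  if h : ∃ w, PL.HasIntegral f u w then h.choose else 0

/-- Simple functions that approximate `f` in `L²(μ_u)` for all `u ∈ D_f` simultaneously. -/
theorem exists_approx {f : halfPlane ι → ℍ[ℝ]} (hf : Measurable f) :
    ∃ s : ℕ → SimpleFunc (halfPlane ι) ℍ[ℝ], ∀ u ∈ PL.squareDomain f,
      Tendsto (fun n => eLpNorm (⇑(s n) - f) 2 (PL.measure u)) atTop (𝓝 0) :=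
  ⟨fun n => SimpleFunc.approxOn f hf Set.univ 0 (Set.mem_univ _) n, fun _ hu =>
    SimpleFunc.tendsto_approxOn_Lp_eLpNorm hf (Set.mem_univ _) (by norm_num) (by simp)
      (by simpa using hu.2)⟩

theorem enorm_integralSimple_sub_le {f : halfPlane ι → ℍ[ℝ]} (hf : Measurable f)
    (s t : SimpleFunc (halfPlane ι) ℍ[ℝ]) (u : H) :
    ‖PL.integralSimple s u - PL.integralSimple t u‖ₑ ≤
      eLpNorm (⇑s - f) 2 (PL.measure u) + eLpNorm (⇑t - f) 2 (PL.measure u) := by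
  rw [← integralSimple_sub, enorm_integralSimple, SimpleFunc.coe_sub,
    eLpNorm_sub_comm (⇑t) f, ← sub_add_sub_cancel (⇑s) f (⇑t)]
  exact eLpNorm_add_le (s.measurable.sub hf).aestronglyMeasurable
    (hf.sub t.measurable).aestronglyMeasurable (by norm_num)

theorem mem_squareDomain_of_bounded {f : halfPlane ι → ℍ[ℝ]} (hf : Measurable f) {C : ℝ}
    (hC : ∀ q, ‖f q‖ ≤ C) (u : H) : u ∈ PL.squareDomain f :=
  PL.mem_squareDomain.mpr (MemLp.of_bound hf.aestronglyMeasurable C (Eventually.of_forall hC))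

theorem eLpNorm_le_of_bounded {f : halfPlane ι → ℍ[ℝ]} {C : ℝ} (hC : ∀ q, ‖f q‖ ≤ C) (u : H) :
    eLpNorm f 2 (PL.measure u) ≤ ENNReal.ofReal C * ‖u‖ₑ := by
  refine (eLpNorm_le_of_ae_bound (Eventually.of_forall hC)).trans (le_of_eq ?_)
  rw [PL.measure_univ, ← ENNReal.rpow_natCast, ← ENNReal.rpow_mul, mul_comm]
  simp

theorem isBoundedIntegral_unique {f : halfPlane ι → ℍ[ℝ]} {S T : H →L[ℍ[ℝ]ᵐᵒᵖ] H}
    (hS : PL.IsBoundedIntegral f S) (hT : PL.IsBoundedIntegral f T) : S = T := by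
  obtain ⟨s, hs⟩ := hS.1
  have key : ∀ {T : H →L[ℍ[ℝ]ᵐᵒᵖ] H}, PL.IsBoundedIntegral f T → ∀ u,
      Tendsto (fun n => PL.integralSimple (s n) u) atTop (𝓝 (T u)) := fun {T} hT u => by
    refine Metric.tendsto_nhds.mpr fun ε hε => ?_
    have hpos : 0 < ε / (‖u‖ + 1) := by positivity
    filter_upwards [hT.2 s hs _ hpos] with n hn
    rw [dist_eq_norm]
    refine (hn u).trans_lt ?_
    rw [div_mul_eq_mul_div, div_lt_iff₀ (by positivity)]
    nlinarith
  exact ContinuousLinearMap.ext fun u => tendsto_nhds_unique (key hS u) (key hT u)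

section Complete

variable [CompleteSpace H]

theorem exists_hasIntegral {f : halfPlane ι → ℍ[ℝ]} (hf : Measurable f) {u : H}
    (hu : u ∈ PL.squareDomain f) : ∃ w, PL.HasIntegral f u w := by
  obtain ⟨s, hs⟩ := PL.exists_approx hf
  specialize hs u hu
  have hc : CauchySeq fun n => PL.integralSimple (s n) u := by
    refine EMetric.cauchySeq_iff.mpr fun ε hε => ?_
    obtain ⟨N, hN⟩ := eventually_atTop.mp
      (hs.eventually (gt_mem_nhds (ENNReal.half_pos hε.ne')))
    refine ⟨N, fun m hm n hn => ?_⟩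
    rw [edist_eq_enorm_sub]
    exact (PL.enorm_integralSimple_sub_le hf _ _ u).trans_lt
      ((ENNReal.add_lt_add (hN m hm) (hN n hn)).trans_eq (ENNReal.add_halves ε))
  obtain ⟨w, hw⟩ := cauchySeq_tendsto_of_complete hc
  refine ⟨w, fun t ht => ?_⟩
  refine tendsto_of_tendsto_of_dist hw ?_
  have h0 : Tendsto (fun n => edist (PL.integralSimple (s n) u) (PL.integralSimple (t n) u))
      atTop (𝓝 0) := by
    refine tendsto_of_tendsto_of_tendsto_of_le_of_le tendsto_const_nhds
      (by simpa using hs.add ht) (fun _ => zero_le) fun n => ?_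
    simp only [edist_eq_enorm_sub]
    exact PL.enorm_integralSimple_sub_le hf _ _ u
  have := (ENNReal.tendsto_toReal ENNReal.zero_ne_top).comp h0
  simpa [Function.comp_def, dist_edist] using this

theorem hasIntegral_strongIntegral {f : halfPlane ι → ℍ[ℝ]} (hf : Measurable f) {u : H}
    (hu : u ∈ PL.squareDomain f) : PL.HasIntegral f u (PL.strongIntegral f u) := by
  have h := PL.exists_hasIntegral hf hu
  rw [strongIntegral, dif_pos h]
  exact h.choose_spec

theorem exists_tendsto_strongIntegral {f : halfPlane ι → ℍ[ℝ]} (hf : Measurable f) :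
    ∃ s : ℕ → SimpleFunc (halfPlane ι) ℍ[ℝ], ∀ u ∈ PL.squareDomain f,
      Tendsto (fun n => eLpNorm (⇑(s n) - f) 2 (PL.measure u)) atTop (𝓝 0) ∧
      Tendsto (fun n => PL.integralSimple (s n) u) atTop (𝓝 (PL.strongIntegral f u)) := by
  obtain ⟨s, hs⟩ := PL.exists_approx hf
  exact ⟨s, fun u hu => ⟨hs u hu, PL.hasIntegral_strongIntegral hf hu s (hs u hu)⟩⟩

theorem enorm_strongIntegral {f : halfPlane ι → ℍ[ℝ]} (hf : Measurable f) {u : H}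
    (hu : u ∈ PL.squareDomain f) :
    ‖PL.strongIntegral f u‖ₑ = eLpNorm f 2 (PL.measure u) := by
  obtain ⟨s, hs⟩ := PL.exists_tendsto_strongIntegral hf
  obtain ⟨h0, h1⟩ := hs u hu
  have h2 := h1.enorm
  refine le_antisymm ?_ ?_
  · have h3 : Tendsto (fun n => eLpNorm (⇑(s n) - f) 2 (PL.measure u) +
        eLpNorm f 2 (PL.measure u)) atTop (𝓝 (eLpNorm f 2 (PL.measure u))) := by
      simpa using h0.add_const (eLpNorm f 2 (PL.measure u))
    refine le_of_tendsto_of_tendsto' h2 h3 fun n => ?_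
    rw [enorm_integralSimple]
    simpa using eLpNorm_add_le ((s n).measurable.sub hf).aestronglyMeasurable
      hf.aestronglyMeasurable (μ := PL.measure u) (p := 2) (by norm_num)
  · have h3 := h0.add h2
    rw [zero_add] at h3
    refine ge_of_tendsto' h3 fun n => ?_
    rw [enorm_integralSimple, eLpNorm_sub_comm]
    simpa using eLpNorm_add_le (hf.sub (s n).measurable).aestronglyMeasurable
      (s n).measurable.aestronglyMeasurable (μ := PL.measure u) (p := 2) (by norm_num)

theorem strongIntegral_simpleFunc (s : SimpleFunc (halfPlane ι) ℍ[ℝ]) (u : H) :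
    PL.strongIntegral s u = PL.integralSimple s u := by
  have h := PL.hasIntegral_strongIntegral s.measurable
    (PL.mem_squareDomain.mpr (s.memLp_of_isFiniteMeasure 2 (PL.measure u))) (fun _ => s) (by simp)
  exact tendsto_nhds_unique h tendsto_const_nhds

theorem strongIntegral_add {f g : halfPlane ι → ℍ[ℝ]} (hf : Measurable f) (hg : Measurable g)
    {u : H} (hu : u ∈ PL.squareDomain f) (hu' : u ∈ PL.squareDomain g) :
    PL.strongIntegral (fun q => f q + g q) u = PL.strongIntegral f u + PL.strongIntegral g u := by
  obtain ⟨s, hs⟩ := PL.exists_tendsto_strongIntegral hf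
  obtain ⟨t, ht⟩ := PL.exists_tendsto_strongIntegral hg
  have hfg : u ∈ PL.squareDomain (fun q => f q + g q) :=
    PL.mem_squareDomain.mpr (MemLp.add (PL.mem_squareDomain.mp hu) (PL.mem_squareDomain.mp hu'))
  have h := PL.hasIntegral_strongIntegral (hf.add hg) hfg (fun n => s n + t n) (by
    refine tendsto_of_tendsto_of_tendsto_of_le_of_le tendsto_const_nhds
      (by simpa using (hs u hu).1.add (ht u hu').1) (fun _ => zero_le) fun n => ?_
    refine le_trans (le_of_eq ?_) (eLpNorm_add_le ((s n).measurable.sub hf).aestronglyMeasurable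
      ((t n).measurable.sub hg).aestronglyMeasurable (by norm_num))
    congr 1
    ext1 x
    simp only [SimpleFunc.coe_add, Pi.sub_apply, Pi.add_apply]
    abel)
  refine tendsto_nhds_unique h ?_
  simpa only [integralSimple_add] using (hs u hu).2.add (ht u hu').2

theorem strongIntegral_sub {f g : halfPlane ι → ℍ[ℝ]} (hf : Measurable f) (hg : Measurable g)
    {u : H} (hu : u ∈ PL.squareDomain f) (hu' : u ∈ PL.squareDomain g) :
    PL.strongIntegral (f - g) u = PL.strongIntegral f u - PL.strongIntegral g u := by
  have hfg : u ∈ PL.squareDomain (f - g) :=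
    PL.mem_squareDomain.mpr (MemLp.sub (PL.mem_squareDomain.mp hu) (PL.mem_squareDomain.mp hu'))
  rw [eq_sub_iff_add_eq, ← PL.strongIntegral_add (hf.sub hg) hg hfg hu']
  simp

theorem enorm_strongIntegral_sub {f g : halfPlane ι → ℍ[ℝ]} (hf : Measurable f)
    (hg : Measurable g) {u : H} (hu : u ∈ PL.squareDomain f) (hu' : u ∈ PL.squareDomain g) :
    ‖PL.strongIntegral f u - PL.strongIntegral g u‖ₑ = eLpNorm (f - g) 2 (PL.measure u) := by
  rw [← PL.strongIntegral_sub hf hg hu hu', PL.enorm_strongIntegral (hf.sub hg)]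
  exact PL.mem_squareDomain.mpr (MemLp.sub hu hu')

theorem tendsto_strongIntegral {f : halfPlane ι → ℍ[ℝ]} {F : ℕ → halfPlane ι → ℍ[ℝ]}
    (hf : Measurable f) (hF : ∀ n, Measurable (F n)) {u : H} (hu : u ∈ PL.squareDomain f)
    (hu' : ∀ n, u ∈ PL.squareDomain (F n))
    (h : Tendsto (fun n => eLpNorm (F n - f) 2 (PL.measure u)) atTop (𝓝 0)) :
    Tendsto (fun n => PL.strongIntegral (F n) u) atTop (𝓝 (PL.strongIntegral f u)) := by
  rw [tendsto_iff_edist_tendsto_0]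
  simpa only [edist_eq_enorm_sub, PL.enorm_strongIntegral_sub (hF _) hf (hu' _) hu] using h

theorem strongIntegral_vec_add {f : halfPlane ι → ℍ[ℝ]} (hf : Measurable f) {u v : H}
    (hu : u ∈ PL.squareDomain f) (hv : v ∈ PL.squareDomain f) :
    PL.strongIntegral f (u + v) = PL.strongIntegral f u + PL.strongIntegral f v := by
  obtain ⟨s, hs⟩ := PL.exists_tendsto_strongIntegral hf
  refine tendsto_nhds_unique (hs _ (add_mem hu hv)).2 ?_
  simpa only [map_add] using (hs u hu).2.add (hs v hv).2

theorem strongIntegral_vec_smul {f : halfPlane ι → ℍ[ℝ]} (hf : Measurable f) {u : H}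
    (c : ℍ[ℝ]ᵐᵒᵖ) (hu : u ∈ PL.squareDomain f) :
    PL.strongIntegral f (c • u) = c • PL.strongIntegral f u := by
  obtain ⟨s, hs⟩ := PL.exists_tendsto_strongIntegral hf
  refine tendsto_nhds_unique (hs _ (Submodule.smul_mem _ c hu)).2 ?_
  simpa only [map_smul, Function.comp_def] using ((continuous_qsmul c).tendsto _).comp (hs u hu).2

/-! ### Bounded functions -/

theorem norm_strongIntegral_le {f : halfPlane ι → ℍ[ℝ]} (hf : Measurable f) {C : ℝ}
    (hC : ∀ q, ‖f q‖ ≤ C) (hC0 : 0 ≤ C) (u : H) : ‖PL.strongIntegral f u‖ ≤ C * ‖u‖ := by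
  have h := PL.eLpNorm_le_of_bounded hC u
  rw [← PL.enorm_strongIntegral hf (PL.mem_squareDomain_of_bounded hf hC u), ← ofReal_norm,
    ← ofReal_norm, ← ENNReal.ofReal_mul hC0] at h
  exact (ENNReal.ofReal_le_ofReal_iff (by positivity)).mp h

/-- The strong integral of a bounded function as a continuous operator. -/
noncomputable def boundedIntegralCLM (f : halfPlane ι → ℍ[ℝ]) (hf : Measurable f)
    (hC : ∃ C, ∀ q, ‖f q‖ ≤ C) : H →L[ℍ[ℝ]ᵐᵒᵖ] H where
  toFun := PL.strongIntegral f
  map_add' u v := by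
    obtain ⟨C, hC⟩ := hC
    exact PL.strongIntegral_vec_add hf (PL.mem_squareDomain_of_bounded hf hC u)
      (PL.mem_squareDomain_of_bounded hf hC v)
  map_smul' c u := by
    obtain ⟨C, hC⟩ := hC
    exact PL.strongIntegral_vec_smul hf c (PL.mem_squareDomain_of_bounded hf hC u)
  cont := by
    obtain ⟨C, hC⟩ := hC
    let φ : H →+ H := AddMonoidHom.mk' (PL.strongIntegral f) fun u v =>
      PL.strongIntegral_vec_add hf (PL.mem_squareDomain_of_bounded hf hC u)
        (PL.mem_squareDomain_of_bounded hf hC v)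
    exact AddMonoidHomClass.continuous_of_bound φ (max C 0) fun u =>
      PL.norm_strongIntegral_le hf (fun q => (hC q).trans (le_max_left _ _)) (le_max_right _ _) u

/-- A bounded measurable function into a proper space is a uniform limit of simple functions. -/
theorem _root_.MeasureTheory.SimpleFunc.exists_tendstoUniformly_of_bounded {α E : Type*}
    [MeasurableSpace α] [NormedAddCommGroup E] [ProperSpace E] [MeasurableSpace E]
    [OpensMeasurableSpace E]
    {f : α → E} (hf : Measurable f) {C : ℝ} (hC : ∀ q, ‖f q‖ ≤ C) :
    ∃ s : ℕ → SimpleFunc α E, TendstoUniformly (fun n => ⇑(s n)) f atTop := by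
  let e := TopologicalSpace.denseSeq E
  have he : DenseRange e := TopologicalSpace.denseRange_denseSeq E
  refine ⟨fun n => (SimpleFunc.nearestPt e n).comp f hf, ?_⟩
  refine Metric.tendstoUniformly_iff.mpr fun ε hε => ?_
  obtain ⟨t, ht⟩ := (isCompact_closedBall (0 : E) C).elim_finite_subcover
    (fun k => Metric.ball (e k) ε) (fun _ => Metric.isOpen_ball) fun x _ => by
      obtain ⟨k, hk⟩ := he.exists_dist_lt x hε
      exact Set.mem_iUnion.mpr ⟨k, hk⟩
  filter_upwards [eventually_ge_atTop (t.sup id)] with n hn x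
  have hx : f x ∈ Metric.closedBall (0 : E) C := by simpa using hC x
  obtain ⟨k, hkt, hk⟩ := Set.mem_iUnion₂.mp (ht hx)
  have h1 := SimpleFunc.edist_nearestPt_le e (f x) ((Finset.le_sup (f := id) hkt).trans hn)
  rw [edist_dist, edist_dist, ENNReal.ofReal_le_ofReal_iff dist_nonneg] at h1
  rw [dist_comm]
  exact h1.trans_lt (by rw [dist_comm]; exact hk)

theorem isBoundedIntegral_boundedIntegralCLM {f : halfPlane ι → ℍ[ℝ]} (hf : Measurable f)
    (hC : ∃ C, ∀ q, ‖f q‖ ≤ C) : PL.IsBoundedIntegral f (PL.boundedIntegralCLM f hf hC) := by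
  obtain ⟨C, hC'⟩ := id hC
  refine ⟨SimpleFunc.exists_tendstoUniformly_of_bounded hf hC', fun s hs ε hε => ?_⟩
  filter_upwards [Metric.tendstoUniformly_iff.mp hs ε hε] with n hn u
  change ‖PL.integralSimple (s n) u - PL.strongIntegral f u‖ ≤ _
  have hsu : u ∈ PL.squareDomain (s n) :=
    PL.mem_squareDomain.mpr ((s n).memLp_of_isFiniteMeasure 2 _)
  rw [← strongIntegral_simpleFunc, ← PL.strongIntegral_sub (s n).measurable hf hsu
    (PL.mem_squareDomain_of_bounded hf hC' u)]
  refine PL.norm_strongIntegral_le ((s n).measurable.sub hf) (fun q => ?_) hε.le u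
  rw [Pi.sub_apply, ← dist_eq_norm, dist_comm]
  exact (hn q).le

theorem isBoundedIntegral_integralBounded {f : halfPlane ι → ℍ[ℝ]} (hf : Measurable f)
    (hC : ∃ C, ∀ q, ‖f q‖ ≤ C) : PL.IsBoundedIntegral f (PL.integralBounded f) := by
  have h : ∃ T, PL.IsBoundedIntegral f T := ⟨_, PL.isBoundedIntegral_boundedIntegralCLM hf hC⟩
  rw [integralBounded, dif_pos h]
  exact h.choose_spec

theorem integralBounded_apply {f : halfPlane ι → ℍ[ℝ]} (hf : Measurable f)
    (hC : ∃ C, ∀ q, ‖f q‖ ≤ C) (u : H) : PL.integralBounded f u = PL.strongIntegral f u := by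
  rw [PL.isBoundedIntegral_unique (PL.isBoundedIntegral_integralBounded hf hC)
    (PL.isBoundedIntegral_boundedIntegralCLM hf hC)]
  rfl

/-! ### Truncations and the integral of unbounded functions -/

theorem measurable_truncation {f : halfPlane ι → ℍ[ℝ]} (hf : Measurable f) (n : ℕ) :
    Measurable (truncation f n) :=
  Measurable.ite (measurableSet_le hf.norm measurable_const) hf measurable_const

theorem norm_truncation_le (f : halfPlane ι → ℍ[ℝ]) (n : ℕ) (q : halfPlane ι) :
    ‖truncation f n q‖ ≤ n := by
  unfold truncation
  split_ifs with h
  · exact h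
  · simp

theorem norm_truncation_sub_le (f : halfPlane ι → ℍ[ℝ]) (n : ℕ) (q : halfPlane ι) :
    ‖truncation f n q - f q‖ ≤ ‖f q‖ := by
  unfold truncation
  split_ifs with h <;> simp

theorem tendsto_truncation (f : halfPlane ι → ℍ[ℝ]) (q : halfPlane ι) :
    Tendsto (fun n => truncation f n q) atTop (𝓝 (f q)) := by
  refine tendsto_const_nhds.congr' ?_
  filter_upwards [eventually_ge_atTop ⌈‖f q‖⌉₊] with n hn
  rw [truncation, if_pos ((Nat.le_ceil _).trans (by exact_mod_cast hn))]

/-- Dominated convergence in `L²(μ_u)`. -/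
theorem tendsto_eLpNorm_zero_of_dominated {α E : Type*} [MeasurableSpace α] {μ : Measure α}
    [NormedAddCommGroup E] {F : ℕ → α → E} {g : α → E} (hF : ∀ n, AEStronglyMeasurable (F n) μ)
    (hg : MemLp g 2 μ) (hb : ∀ n x, ‖F n x‖ ≤ ‖g x‖)
    (hlim : ∀ x, Tendsto (fun n => F n x) atTop (𝓝 0)) :
    Tendsto (fun n => eLpNorm (F n) 2 μ) atTop (𝓝 0) := by
  have hfin : ∫⁻ x, ‖g x‖ₑ ^ 2 ∂μ ≠ ∞ := by
    rw [← eLpNorm_two_sq]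
    exact ENNReal.pow_ne_top hg.2.ne
  have h : Tendsto (fun n => ∫⁻ x, ‖F n x‖ₑ ^ 2 ∂μ) atTop (𝓝 (∫⁻ _, 0 ∂μ)) := by
    refine tendsto_lintegral_of_dominated_convergence' (fun x => ‖g x‖ₑ ^ 2)
      (fun n => (hF n).enorm.pow_const 2) (fun n => Eventually.of_forall fun x => ?_) hfin
      (Eventually.of_forall fun x => ?_)
    · exact pow_le_pow_left' (enorm_le_iff_norm_le.mpr (hb n x)) 2
    · have := (ENNReal.continuous_pow 2).tendsto 0 |>.comp ((hlim x).enorm.trans (by simp))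
      simpa [Function.comp_def] using this
  have h2 := ((ENNReal.continuous_rpow_const (y := (1 / 2 : ℝ))).tendsto _).comp h
  simp only [Function.comp_def, ← eLpNorm_two_sq, lintegral_zero] at h2
  convert h2 using 2
  · rw [← ENNReal.rpow_natCast, ← ENNReal.rpow_mul]; simp
  · simp

theorem tendsto_integralBounded_truncation {f : halfPlane ι → ℍ[ℝ]} (hf : Measurable f) {u : H}
    (hu : u ∈ PL.squareDomain f) :
    Tendsto (fun n : ℕ => PL.integralBounded (truncation f n) u) atTop
      (𝓝 (PL.strongIntegral f u)) := by
  simp only [PL.integralBounded_apply (measurable_truncation hf _) ⟨_, norm_truncation_le f _⟩]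
  refine PL.tendsto_strongIntegral hf (measurable_truncation hf) hu (fun n =>
    PL.mem_squareDomain_of_bounded (measurable_truncation hf n) (norm_truncation_le f n) u) ?_
  refine tendsto_eLpNorm_zero_of_dominated
    (fun n => ((measurable_truncation hf n).sub hf).aestronglyMeasurable) hu
    (norm_truncation_sub_le f) fun x => ?_
  simpa using (tendsto_truncation f x).sub_const (f x)

theorem mem_integralGraph {f : halfPlane ι → ℍ[ℝ]} (hf : Measurable f) {p : H × H} :
    p ∈ PL.integralGraph f ↔ p.1 ∈ PL.squareDomain f ∧ p.2 = PL.strongIntegral f p.1 := by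
  refine ⟨fun h => ⟨h.1, tendsto_nhds_unique h.2 (PL.tendsto_integralBounded_truncation hf h.1)⟩,
    fun h => ⟨h.1, ?_⟩⟩
  rw [h.2]
  exact PL.tendsto_integralBounded_truncation hf h.1

theorem graph_integral {f : halfPlane ι → ℍ[ℝ]} (hf : Measurable f) :
    (PL.integral f).graph = PL.integralGraph f := by
  refine Submodule.toLinearPMap_graph_eq _ fun p hp h0 => ?_
  have h1 := ((PL.mem_integralGraph hf).mp hp).2
  have h2 := PL.strongIntegral_vec_smul hf 0 (zero_mem (PL.squareDomain f))
  rw [zero_smul, zero_smul] at h2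
  rw [h1, h0, h2]

theorem mem_graph_integral {f : halfPlane ι → ℍ[ℝ]} (hf : Measurable f) {u w : H} :
    (u, w) ∈ (PL.integral f).graph ↔ u ∈ PL.squareDomain f ∧ w = PL.strongIntegral f u := by
  rw [PL.graph_integral hf, PL.mem_integralGraph hf]

theorem domain_integral {f : halfPlane ι → ℍ[ℝ]} (hf : Measurable f) :
    (PL.integral f).domain = PL.squareDomain f := by
  ext u
  rw [LinearPMap.mem_domain_iff]
  simp only [PL.mem_graph_integral hf, exists_and_left, exists_eq, and_true]

theorem integral_apply {f : halfPlane ι → ℍ[ℝ]} (hf : Measurable f)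
    (u : (PL.integral f).domain) : PL.integral f u = PL.strongIntegral f u :=
  ((PL.mem_graph_integral hf).mp ((PL.integral f).mem_graph u)).2

end Complete

end QuaternionicIntegral.IqPVM

namespace QuaternionicIntegral

section Operators

variable {H : Type*} [NormedAddCommGroup H] [Module ℍ[ℝ]ᵐᵒᵖ H]

theorem mem_graph_opComp [QInnerProductSpace H] (T S : H →ₗ.[ℍ[ℝ]ᵐᵒᵖ] H) {u w : H} :
    (u, w) ∈ (opComp T S).graph ↔ ∃ v, (u, v) ∈ S.graph ∧ (v, w) ∈ T.graph := by
  simp only [LinearPMap.mem_graph_iff]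
  constructor
  · rintro ⟨⟨x, hx⟩, rfl, rfl⟩
    obtain ⟨y, hy, rfl⟩ := hx.1
    exact ⟨S y, ⟨y, rfl, rfl⟩, ⟨S y, hy⟩, rfl, rfl⟩
  · rintro ⟨v, ⟨y, rfl, rfl⟩, ⟨z, hz, rfl⟩⟩
    have hy : S y ∈ T.domain := hz ▸ z.2
    refine ⟨⟨y, ⟨⟨y, hy, rfl⟩, y.2⟩⟩, rfl, ?_⟩
    have hz' : z = ⟨S y, hy⟩ := Subtype.ext hz
    rw [hz']
    rfl

theorem mem_graph_add (T S : H →ₗ.[ℍ[ℝ]ᵐᵒᵖ] H) {u w : H} :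
    (u, w) ∈ (T + S).graph ↔ ∃ v v', (u, v) ∈ T.graph ∧ (u, v') ∈ S.graph ∧ w = v + v' := by
  simp only [LinearPMap.mem_graph_iff]
  constructor
  · rintro ⟨⟨x, hx⟩, rfl, rfl⟩
    exact ⟨_, _, ⟨⟨x, hx.1⟩, rfl, rfl⟩, ⟨⟨x, hx.2⟩, rfl, rfl⟩, rfl⟩
  · rintro ⟨_, _, ⟨y, hy, rfl⟩, ⟨z, hz, rfl⟩, rfl⟩
    subst hy
    have hy : (y : H) ∈ S.domain := hz ▸ z.2
    obtain rfl : z = ⟨y, hy⟩ := Subtype.ext hz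
    exact ⟨⟨y, y.2, hy⟩, rfl, rfl⟩

/-- An operator that is the restriction of `S` to `D` has domain `D`, is contained in `S`, and
equals `S` if and only if `D(S) ⊂ D`. -/
theorem restriction_of_graph {T S : H →ₗ.[ℍ[ℝ]ᵐᵒᵖ] H} {D : Submodule ℍ[ℝ]ᵐᵒᵖ H}
    (hD : D ≤ S.domain) (h : ∀ u w, (u, w) ∈ T.graph ↔ u ∈ D ∧ (u, w) ∈ S.graph) :
    T.domain = D ∧ T ≤ S ∧ (T = S ↔ S.domain ≤ D) := by
  have hdom : T.domain = D := by
    ext u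
    rw [LinearPMap.mem_domain_iff]
    simp only [h, exists_and_left, ← LinearPMap.mem_domain_iff]
    exact and_iff_left_of_imp fun hu => hD hu
  refine ⟨hdom, LinearPMap.le_of_le_graph fun p hp => ((h p.1 p.2).mp hp).2, ?_, ?_⟩
  · rintro rfl
    exact hdom.le
  · refine fun hle => LinearPMap.eq_of_eq_graph (Submodule.ext fun p => ?_)
    refine (h p.1 p.2).trans (and_iff_right_of_imp fun hp => hle ?_)
    exact LinearPMap.mem_domain_iff.mpr ⟨_, hp⟩

theorem isClosed_adjointGraph [QInnerProductSpace H] (T : H →ₗ.[ℍ[ℝ]ᵐᵒᵖ] H) :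
    IsClosed (adjointGraph T : Set (H × H)) := by
  have : (adjointGraph T : Set (H × H)) =
      ⋂ v : T.domain, {p | qinner p.2 (v : H) = qinner p.1 (T v)} := by
    ext p
    simp only [Set.mem_iInter]
    rfl
  rw [this]
  exact isClosed_iInter fun v => isClosed_eq ((continuous_qinner_left _).comp continuous_snd)
    ((continuous_qinner_left _).comp continuous_fst)

end Operators

namespace IqPVM

variable {ι : ℍ[ℝ]} {H : Type*} [NormedAddCommGroup H] [Module ℍ[ℝ]ᵐᵒᵖ H] [QInnerProductSpace H]
  (PL : IqPVM ι H)

/-! ### Products -/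

/-- The indicator function of a Borel set, as a simple function. -/
noncomputable def indicatorFunc {E : Set (halfPlane ι)} (hE : MeasurableSet E) :
    SimpleFunc (halfPlane ι) ℍ[ℝ] :=
  haveI := Classical.decPred (· ∈ E)
  SimpleFunc.piecewise E hE (SimpleFunc.const _ 1) (SimpleFunc.const _ 0)

open scoped Classical in
theorem indicatorFunc_apply {E : Set (halfPlane ι)} (hE : MeasurableSet E) (q : halfPlane ι) :
    indicatorFunc hE q = if q ∈ E then 1 else 0 := by
  simp [indicatorFunc, SimpleFunc.piecewise_apply]

theorem integralSimple_indicatorFunc {E : Set (halfPlane ι)} (hE : MeasurableSet E) (u : H) :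
    PL.integralSimple (indicatorFunc hE) u = PL.P E u := by
  rw [← PL.integralSimple_indicator hE]
  congr!

theorem mem_squareDomain_simpleFunc (s : SimpleFunc (halfPlane ι) ℍ[ℝ]) (u : H) :
    u ∈ PL.squareDomain s :=
  PL.mem_squareDomain.mpr (s.memLp_of_isFiniteMeasure 2 _)

theorem mem_squareDomain_of_norm_le {f g : halfPlane ι → ℍ[ℝ]} (hf : Measurable f) {u : H}
    (hu : u ∈ PL.squareDomain g) (h : ∀ q, ‖f q‖ ≤ ‖g q‖) : u ∈ PL.squareDomain f :=
  PL.mem_squareDomain.mpr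
    (MemLp.of_le (PL.mem_squareDomain.mp hu) hf.aestronglyMeasurable (Eventually.of_forall h))

theorem squareDomain_star (f : halfPlane ι → ℍ[ℝ]) (hf : Measurable f) :
    PL.squareDomain f = PL.squareDomain fun q => star (f q) := by
  ext u
  exact ⟨fun h => PL.mem_squareDomain_of_norm_le (continuous_star.measurable.comp hf) h
      fun q => (norm_star _).le,
    fun h => PL.mem_squareDomain_of_norm_le hf h fun q => (norm_star _).ge⟩

theorem mem_squareDomain_simpleFunc_mul {g : halfPlane ι → ℍ[ℝ]} (hg : Measurable g)
    (s : SimpleFunc (halfPlane ι) ℍ[ℝ]) {u : H} (hu : u ∈ PL.squareDomain g) :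
    u ∈ PL.squareDomain fun q => s q * g q := by
  obtain ⟨C, hC⟩ := s.exists_forall_norm_le
  refine PL.mem_squareDomain.mpr (MemLp.of_le_mul (PL.mem_squareDomain.mp hu) (c := C)
    (s.measurable.fun_mul hg).aestronglyMeasurable (Eventually.of_forall fun q => ?_))
  rw [norm_mul]
  gcongr
  exact hC q

section Complete

variable [CompleteSpace H]

theorem integralSimple_strongIntegral {g : halfPlane ι → ℍ[ℝ]} (hg : Measurable g)
    (s : SimpleFunc (halfPlane ι) ℍ[ℝ]) {u : H} (hu : u ∈ PL.squareDomain g) :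
    PL.integralSimple s (PL.strongIntegral g u) = PL.strongIntegral (fun q => s q * g q) u := by
  obtain ⟨t, ht⟩ := PL.exists_tendsto_strongIntegral hg
  obtain ⟨h0, h1⟩ := ht u hu
  obtain ⟨C, hC⟩ := s.exists_forall_norm_le
  have h2 := PL.hasIntegral_strongIntegral (s.measurable.fun_mul hg)
    (PL.mem_squareDomain_simpleFunc_mul hg s hu) (fun n => s * t n) (by
      have h3 := ENNReal.Tendsto.const_mul (a := ENNReal.ofReal C) h0 (Or.inr (by simp))
      rw [mul_zero] at h3
      refine tendsto_of_tendsto_of_tendsto_of_le_of_le tendsto_const_nhds h3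
        (fun _ => zero_le) fun n => ?_
      refine eLpNorm_le_mul_eLpNorm_of_ae_le_mul (Eventually.of_forall fun q => ?_) 2
      simp only [Pi.sub_apply, SimpleFunc.coe_mul, Pi.mul_def, ← mul_sub, norm_mul]
      gcongr
      exact hC q)
  refine tendsto_nhds_unique ?_ h2
  simp only [integralSimple_mul]
  exact ((PL.integralSimple s).continuous.tendsto _).comp h1

theorem measure_strongIntegral {g : halfPlane ι → ℍ[ℝ]} (hg : Measurable g) {u : H}
    (hu : u ∈ PL.squareDomain g) :
    PL.measure (PL.strongIntegral g u) = (PL.measure u).withDensity fun q => ‖g q‖ₑ ^ 2 := by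
  classical
  refine Measure.ext fun E hE => ?_
  rw [PL.measure_eq_enorm_sq _ hE, ← PL.integralSimple_indicatorFunc hE,
    PL.integralSimple_strongIntegral hg _ hu,
    PL.enorm_strongIntegral ((indicatorFunc hE).measurable.fun_mul hg)
      (PL.mem_squareDomain_simpleFunc_mul hg _ hu), eLpNorm_two_sq, withDensity_apply _ hE,
    ← lintegral_indicator hE]
  refine lintegral_congr fun q => ?_
  by_cases hq : q ∈ E <;> simp [indicatorFunc_apply, hq]

theorem eLpNorm_strongIntegral {f g : halfPlane ι → ℍ[ℝ]} (hf : Measurable f) (hg : Measurable g)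
    {u : H} (hu : u ∈ PL.squareDomain g) :
    eLpNorm f 2 (PL.measure (PL.strongIntegral g u)) =
      eLpNorm (fun q => f q * g q) 2 (PL.measure u) := by
  refine eq_of_sq_eq_sq ?_
  rw [eLpNorm_two_sq, eLpNorm_two_sq, PL.measure_strongIntegral hg hu,
    lintegral_withDensity_eq_lintegral_mul _ (hg.enorm.pow_const 2) (hf.enorm.pow_const 2)]
  refine lintegral_congr fun q => ?_
  rw [Pi.mul_apply, enorm_mul, mul_pow, mul_comm]

theorem strongIntegral_mem_squareDomain {f g : halfPlane ι → ℍ[ℝ]} (hf : Measurable f)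
    (hg : Measurable g) {u : H} (hu : u ∈ PL.squareDomain g) :
    PL.strongIntegral g u ∈ PL.squareDomain f ↔ u ∈ PL.squareDomain fun q => f q * g q := by
  rw [PL.mem_squareDomain_iff_lt_top hf, PL.mem_squareDomain_iff_lt_top (hf.fun_mul hg),
    PL.eLpNorm_strongIntegral hf hg hu]

theorem strongIntegral_strongIntegral {f g : halfPlane ι → ℍ[ℝ]} (hf : Measurable f)
    (hg : Measurable g) {u : H} (hu : u ∈ PL.squareDomain g)
    (hu' : u ∈ PL.squareDomain fun q => f q * g q) :
    PL.strongIntegral f (PL.strongIntegral g u) = PL.strongIntegral (fun q => f q * g q) u := by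
  obtain ⟨s, hs⟩ := PL.exists_tendsto_strongIntegral hf
  obtain ⟨h0, h1⟩ := hs _ ((PL.strongIntegral_mem_squareDomain hf hg hu).mpr hu')
  refine tendsto_nhds_unique h1 ?_
  simp only [PL.integralSimple_strongIntegral hg _ hu]
  refine PL.tendsto_strongIntegral (hf.fun_mul hg) (fun n => (s n).measurable.fun_mul hg) hu'
    (fun n => PL.mem_squareDomain_simpleFunc_mul hg (s n) hu) (h0.congr fun n => ?_)
  rw [PL.eLpNorm_strongIntegral ((s n).measurable.sub hf) hg hu]
  congr 1
  ext1 q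
  simp only [Pi.sub_apply, sub_mul]

theorem opComp_integral {f g : halfPlane ι → ℍ[ℝ]} (hf : Measurable f) (hg : Measurable g) :
    (opComp (PL.integral f) (PL.integral g)).domain =
        PL.squareDomain g ⊓ PL.squareDomain (fun q => f q * g q) ∧
      opComp (PL.integral f) (PL.integral g) ≤ PL.integral (fun q => f q * g q) ∧
      (opComp (PL.integral f) (PL.integral g) = PL.integral (fun q => f q * g q) ↔
        PL.squareDomain (fun q => f q * g q) ≤ PL.squareDomain g) := by
  have hdom := PL.domain_integral (hf.fun_mul hg)
  have h := restriction_of_graph (T := opComp (PL.integral f) (PL.integral g))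
    (S := PL.integral fun q => f q * g q)
    (D := PL.squareDomain g ⊓ PL.squareDomain (fun q => f q * g q))
    (hdom.symm ▸ inf_le_right) fun u w => by
      rw [mem_graph_opComp, PL.mem_graph_integral (hf.fun_mul hg), Submodule.mem_inf]
      simp only [PL.mem_graph_integral hf, PL.mem_graph_integral hg]
      constructor
      · rintro ⟨_, ⟨hu, rfl⟩, hv, rfl⟩
        have hu' := (PL.strongIntegral_mem_squareDomain hf hg hu).mp hv
        exact ⟨⟨hu, hu'⟩, hu', PL.strongIntegral_strongIntegral hf hg hu hu'⟩
      · rintro ⟨⟨hu, hu'⟩, -, rfl⟩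
        exact ⟨_, ⟨hu, rfl⟩, (PL.strongIntegral_mem_squareDomain hf hg hu).mpr hu',
          (PL.strongIntegral_strongIntegral hf hg hu hu').symm⟩
  refine ⟨h.1, h.2.1, h.2.2.trans ?_⟩
  rw [hdom, le_inf_iff]
  exact and_iff_left le_rfl

/-! ### Sums -/

theorem integral_add {f g : halfPlane ι → ℍ[ℝ]} (hf : Measurable f) (hg : Measurable g) :
    (PL.integral f + PL.integral g).domain = PL.squareDomain f ⊓ PL.squareDomain g ∧
      PL.integral f + PL.integral g ≤ PL.integral (fun q => f q + g q) ∧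
      (PL.integral f + PL.integral g = PL.integral (fun q => f q + g q) ↔
        PL.squareDomain (fun q => f q + g q) ≤ PL.squareDomain f ⊓ PL.squareDomain g) := by
  have hdom := PL.domain_integral (hf.fun_add hg)
  have hle : PL.squareDomain f ⊓ PL.squareDomain g ≤ PL.squareDomain fun q => f q + g q :=
    fun u hu => PL.mem_squareDomain.mpr
      (MemLp.add (PL.mem_squareDomain.mp hu.1) (PL.mem_squareDomain.mp hu.2))
  have h := restriction_of_graph (T := PL.integral f + PL.integral g)
    (S := PL.integral fun q => f q + g q) (D := PL.squareDomain f ⊓ PL.squareDomain g)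
    (hdom.symm ▸ hle) fun u w => by
      rw [mem_graph_add, PL.mem_graph_integral (hf.fun_add hg), Submodule.mem_inf]
      simp only [PL.mem_graph_integral hf, PL.mem_graph_integral hg]
      constructor
      · rintro ⟨_, _, ⟨hu, rfl⟩, ⟨hu', rfl⟩, rfl⟩
        exact ⟨⟨hu, hu'⟩, hle ⟨hu, hu'⟩, (PL.strongIntegral_add hf hg hu hu').symm⟩
      · rintro ⟨⟨hu, hu'⟩, -, rfl⟩
        exact ⟨_, _, ⟨hu, rfl⟩, ⟨hu', rfl⟩, PL.strongIntegral_add hf hg hu hu'⟩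
  refine ⟨h.1, h.2.1, h.2.2.trans ?_⟩
  rw [hdom]

end Complete

end IqPVM

end QuaternionicIntegral

namespace QuaternionicIntegral.IqPVM

variable {ι : ℍ[ℝ]} {H : Type*} [NormedAddCommGroup H] [Module ℍ[ℝ]ᵐᵒᵖ H] [QInnerProductSpace H]
  (PL : IqPVM ι H)

/-! ### Cutoffs and density -/

theorem measurable_star_comp {f : halfPlane ι → ℍ[ℝ]} (hf : Measurable f) :
    Measurable fun q => star (f q) :=
  continuous_star.measurable.comp hf

theorem norm_indicatorFunc_le {E : Set (halfPlane ι)} (hE : MeasurableSet E) (q : halfPlane ι) :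
    ‖indicatorFunc hE q‖ ≤ 1 := by
  classical
  rw [indicatorFunc_apply]
  split_ifs <;> simp

/-- The indicator function of `{|f| ≤ n}`. -/
noncomputable def cutoff {f : halfPlane ι → ℍ[ℝ]} (hf : Measurable f) (n : ℕ) :
    SimpleFunc (halfPlane ι) ℍ[ℝ] :=
  indicatorFunc (measurableSet_le hf.norm (measurable_const (a := (n : ℝ))))

theorem mul_cutoff {f : halfPlane ι → ℍ[ℝ]} (hf : Measurable f) (n : ℕ) (q : halfPlane ι) :
    f q * cutoff hf n q = truncation f n q := by
  classical
  by_cases h : ‖f q‖ ≤ n <;> simp [cutoff, truncation, indicatorFunc_apply, h]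

theorem truncation_star (f : halfPlane ι → ℍ[ℝ]) (n : ℕ) (q : halfPlane ι) :
    truncation (fun q => star (f q)) n q = star (truncation f n q) := by
  by_cases h : ‖f q‖ ≤ n <;> simp [truncation, h]

theorem map_star_cutoff {f : halfPlane ι → ℍ[ℝ]} (hf : Measurable f) (n : ℕ) :
    (cutoff hf n).map star = cutoff hf n := by
  classical
  ext1 q
  by_cases h : ‖f q‖ ≤ n <;> simp [cutoff, indicatorFunc_apply, h]

theorem norm_cutoff_le {f : halfPlane ι → ℍ[ℝ]} (hf : Measurable f) (n : ℕ) (q : halfPlane ι) :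
    ‖cutoff hf n q‖ ≤ 1 := norm_indicatorFunc_le _ q

theorem tendsto_eLpNorm_cutoff {f : halfPlane ι → ℍ[ℝ]} (hf : Measurable f) (u : H) :
    Tendsto (fun n => eLpNorm (⇑(cutoff hf n) - 1) 2 (PL.measure u)) atTop (𝓝 0) := by
  classical
  refine tendsto_eLpNorm_zero_of_dominated (g := fun _ => (1 : ℍ[ℝ]))
    (fun n => ((cutoff hf n).measurable.sub measurable_const).aestronglyMeasurable)
    (memLp_const 1) (fun n q => ?_) fun q => ?_
  · by_cases h : ‖f q‖ ≤ n <;> simp [cutoff, indicatorFunc_apply, h]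
  · refine tendsto_const_nhds.congr' ?_
    filter_upwards [eventually_ge_atTop ⌈‖f q‖⌉₊] with n hn
    have h : ‖f q‖ ≤ n := (Nat.le_ceil _).trans (by exact_mod_cast hn)
    simp [cutoff, indicatorFunc_apply, h]

theorem squareDomain_norm_sq_le {f : halfPlane ι → ℍ[ℝ]} (hf : Measurable f) :
    PL.squareDomain (fun q => ((‖f q‖ ^ 2 : ℝ) : ℍ[ℝ])) ≤ PL.squareDomain f := fun u hu => by
  have h1 := (PL.mem_squareDomain.mp hu).norm.add (memLp_const (1 : ℝ))
  refine PL.mem_squareDomain.mpr (MemLp.of_le h1 hf.aestronglyMeasurable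
    (Eventually.of_forall fun q => ?_))
  simp only [Pi.add_apply, Quaternion.norm_coe]
  rw [Real.norm_of_nonneg (by positivity), Real.norm_of_nonneg (by positivity)]
  nlinarith [sq_nonneg (‖f q‖ - 1), norm_nonneg (f q)]

theorem isEssBounded_iff {f : halfPlane ι → ℍ[ℝ]} :
    PL.IsEssBounded f ↔ ∃ k : ℝ≥0, PL.P {q | (k : ℝ) < ‖f q‖} = 0 := by
  simp only [IsEssBounded, essNorm, iInf_lt_iff]
  exact ⟨fun ⟨k, hk, _⟩ => ⟨k, hk⟩, fun ⟨k, hk⟩ => ⟨k, hk, ENNReal.coe_lt_top⟩⟩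

theorem squareDomain_eq_top_of_isEssBounded {f : halfPlane ι → ℍ[ℝ]} (hf : Measurable f)
    (h : PL.IsEssBounded f) : PL.squareDomain f = ⊤ := by
  obtain ⟨k, hk⟩ := PL.isEssBounded_iff.mp h
  refine eq_top_iff.mpr fun u _ => PL.mem_squareDomain.mpr
    (MemLp.of_bound hf.aestronglyMeasurable k ?_)
  rw [ae_iff]
  simp only [not_le]
  rw [PL.measure_eq_enorm_sq u (measurableSet_lt measurable_const hf.norm), hk]
  simp

section Complete

variable [CompleteSpace H]

theorem tendsto_integralSimple_cutoff {f : halfPlane ι → ℍ[ℝ]} (hf : Measurable f) (u : H) :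
    Tendsto (fun n => PL.integralSimple (cutoff hf n) u) atTop (𝓝 u) := by
  have hone : PL.strongIntegral (1 : halfPlane ι → ℍ[ℝ]) u = u := by
    have h1 : (1 : halfPlane ι → ℍ[ℝ]) = indicatorFunc (ι := ι) MeasurableSet.univ := by
      classical
      ext1 q
      simp [indicatorFunc_apply]
    rw [h1, strongIntegral_simpleFunc, integralSimple_indicatorFunc, P_univ_apply]
  have h := PL.hasIntegral_strongIntegral (f := 1) measurable_const
    (PL.mem_squareDomain.mpr (memLp_const (1 : ℍ[ℝ]))) (cutoff hf) (PL.tendsto_eLpNorm_cutoff hf u)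
  rwa [hone] at h

theorem integralSimple_cutoff_mem {f : halfPlane ι → ℍ[ℝ]} (hf : Measurable f) (n : ℕ) (u : H) :
    PL.integralSimple (cutoff hf n) u ∈ PL.squareDomain f ∧
      PL.strongIntegral f (PL.integralSimple (cutoff hf n) u) =
        PL.strongIntegral (truncation f n) u := by
  have hu := PL.mem_squareDomain_simpleFunc (cutoff hf n) u
  have he : (fun q => f q * cutoff hf n q) = truncation f n := funext (mul_cutoff hf n)
  have ht : u ∈ PL.squareDomain fun q => f q * cutoff hf n q := by
    rw [he]
    exact PL.mem_squareDomain_of_bounded (measurable_truncation hf n) (norm_truncation_le f n) u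
  rw [← strongIntegral_simpleFunc,
    PL.strongIntegral_mem_squareDomain hf (cutoff hf n).measurable hu,
    PL.strongIntegral_strongIntegral hf (cutoff hf n).measurable hu ht, he]
  exact ⟨he ▸ ht, rfl⟩

theorem dense_squareDomain {f : halfPlane ι → ℍ[ℝ]} (hf : Measurable f) :
    Dense (PL.squareDomain f : Set H) := fun u =>
  mem_closure_of_tendsto (PL.tendsto_integralSimple_cutoff hf u)
    (Eventually.of_forall fun n => (PL.integralSimple_cutoff_mem hf n u).1)

/-! ### The adjoint -/

theorem qinner_strongIntegral_star {f : halfPlane ι → ℍ[ℝ]} (hf : Measurable f) {u v : H}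
    (hu : u ∈ PL.squareDomain f) (hv : v ∈ PL.squareDomain f) :
    qinner (PL.strongIntegral (fun q => star (f q)) u) v = qinner u (PL.strongIntegral f v) := by
  obtain ⟨s, hs⟩ := PL.exists_tendsto_strongIntegral hf
  have hu' : u ∈ PL.squareDomain fun q => star (f q) := PL.squareDomain_star f hf ▸ hu
  have h1 := PL.hasIntegral_strongIntegral (measurable_star_comp hf) hu'
    (fun n => (s n).map star) ((hs u hu).1.congr fun n => eLpNorm_congr_norm_ae
      (Eventually.of_forall fun q => by
        simp only [Pi.sub_apply, SimpleFunc.map_apply, ← star_sub, norm_star]))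
  refine tendsto_nhds_unique (((continuous_qinner_left v).tendsto _).comp h1) ?_
  refine (((continuous_qinner_right u).tendsto _).comp (hs v hv).2).congr fun n => ?_
  refine Eq.trans ?_ (PL.integralSimple_star ((s n).map star) u v).symm
  have hss : ((s n).map star).map star = s n := by
    ext1 q
    simp only [SimpleFunc.map_apply, star_star]
  rw [hss]
  rfl

theorem adjointGraph_integral {f : halfPlane ι → ℍ[ℝ]} (hf : Measurable f) :
    adjointGraph (PL.integral f) = PL.integralGraph fun q => star (f q) := by
  have hfs := measurable_star_comp hf
  ext ⟨u, w⟩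
  rw [PL.mem_integralGraph hfs, ← PL.squareDomain_star f hf]
  constructor
  · intro h
    replace h : ∀ v ∈ PL.squareDomain f, qinner w v = qinner u (PL.strongIntegral f v) :=
      fun v hv => by
        have h1 := h ⟨v, (PL.domain_integral hf).symm ▸ hv⟩
        rwa [PL.integral_apply hf] at h1
    have key : ∀ n, PL.integralSimple (cutoff hf n) w =
        PL.strongIntegral (truncation (fun q => star (f q)) n) u := fun n => by
      refine ext_qinner_left fun v => ?_
      obtain ⟨h1, h2⟩ := PL.integralSimple_cutoff_mem hf n v
      have hb := PL.mem_squareDomain_of_bounded (measurable_truncation hf n) (norm_truncation_le f n)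
      rw [integralSimple_star, map_star_cutoff, h _ h1, h2,
        ← PL.qinner_strongIntegral_star (measurable_truncation hf n) (hb u) (hb v)]
      simp only [funext (truncation_star f n)]
    have hu : u ∈ PL.squareDomain fun q => star (f q) := by
      rw [PL.mem_squareDomain_iff_lt_top hfs]
      refine lt_of_le_of_lt ?_ (enorm_lt_top (x := w))
      refine (Lp.eLpNorm_lim_le_liminf_eLpNorm
        (fun n => (measurable_truncation hfs n).aestronglyMeasurable) _
        (Eventually.of_forall (tendsto_truncation _))).trans ?_
      refine Filter.liminf_le_of_le (by isBoundedDefault) fun b hb => ?_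
      obtain ⟨n, hn⟩ := hb.exists
      refine hn.trans ?_
      rw [← PL.enorm_strongIntegral (measurable_truncation hfs n)
        (PL.mem_squareDomain_of_bounded (measurable_truncation hfs n) (norm_truncation_le _ n) u),
        ← key, enorm_integralSimple]
      simpa using PL.eLpNorm_le_of_bounded (norm_cutoff_le hf n) w
    refine ⟨(PL.squareDomain_star f hf).symm ▸ hu, ?_⟩
    refine tendsto_nhds_unique (PL.tendsto_integralSimple_cutoff hf w) ?_
    refine (PL.tendsto_integralBounded_truncation hfs hu).congr fun n => ?_
    rw [key, PL.integralBounded_apply (measurable_truncation hfs n) ⟨_, norm_truncation_le _ n⟩]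
  · rintro ⟨hu, hw⟩ v
    change w = PL.strongIntegral _ u at hw
    rw [PL.integral_apply hf, hw]
    exact PL.qinner_strongIntegral_star hf hu (PL.domain_integral hf ▸ v.2)

theorem opAdjoint_integral {f : halfPlane ι → ℍ[ℝ]} (hf : Measurable f) :
    opAdjoint (PL.integral f) = PL.integral fun q => star (f q) := by
  rw [opAdjoint, PL.adjointGraph_integral hf, integral]

theorem opIsClosed_integral {f : halfPlane ι → ℍ[ℝ]} (hf : Measurable f) :
    OpIsClosed (PL.integral f) := by
  have h := PL.adjointGraph_integral (measurable_star_comp hf)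
  simp only [star_star] at h
  rw [OpIsClosed, PL.graph_integral hf, ← h]
  exact isClosed_adjointGraph _

/-! ### Normality -/

theorem opComp_adjoint_self {f : halfPlane ι → ℍ[ℝ]} (hf : Measurable f) :
    opComp (opAdjoint (PL.integral f)) (PL.integral f) =
      PL.integral (fun q => ((‖f q‖ ^ 2 : ℝ) : ℍ[ℝ])) := by
  have he : (fun q => star (f q) * f q) = fun q => ((‖f q‖ ^ 2 : ℝ) : ℍ[ℝ]) := funext fun q => by
    rw [Quaternion.star_mul_self, Quaternion.normSq_eq_norm_mul_self, pow_two]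
  have h := (PL.opComp_integral (measurable_star_comp hf) hf).2.2
  rw [he] at h
  rw [PL.opAdjoint_integral hf]
  exact h.mpr (PL.squareDomain_norm_sq_le hf)

theorem opComp_self_adjoint {f : halfPlane ι → ℍ[ℝ]} (hf : Measurable f) :
    opComp (PL.integral f) (opAdjoint (PL.integral f)) =
      PL.integral (fun q => ((‖f q‖ ^ 2 : ℝ) : ℍ[ℝ])) := by
  have he : (fun q => f q * star (f q)) = fun q => ((‖f q‖ ^ 2 : ℝ) : ℍ[ℝ]) := funext fun q => by
    rw [Quaternion.self_mul_star, Quaternion.normSq_eq_norm_mul_self, pow_two]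
  have h := (PL.opComp_integral hf (measurable_star_comp hf)).2.2
  rw [he, ← PL.squareDomain_star f hf] at h
  rw [PL.opAdjoint_integral hf]
  exact h.mpr (PL.squareDomain_norm_sq_le hf)

/-! ### Essential boundedness -/

/-- The real normed space underlying a quaternionic Hilbert space. -/
noncomputable abbrev _root_.QuaternionicIntegral.realNormedSpace (H : Type*)
    [NormedAddCommGroup H] [Module ℍ[ℝ]ᵐᵒᵖ H] [QInnerProductSpace H] : NormedSpace ℝ H :=
  letI : Module ℝ H := Module.compHom H (algebraMap ℝ ℍ[ℝ]ᵐᵒᵖ)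
  { norm_smul_le := fun r u => by
      change ‖algebraMap ℝ ℍ[ℝ]ᵐᵒᵖ r • u‖ ≤ _
      rw [norm_qsmul]
      simp [MulOpposite.algebraMap_apply] }

/-- An everywhere defined integral is bounded, by the closed graph theorem. -/
theorem exists_bound_of_squareDomain_eq_top {f : halfPlane ι → ℍ[ℝ]} (hf : Measurable f)
    (h : PL.squareDomain f = ⊤) : ∃ M : ℝ, ∀ u, ‖PL.strongIntegral f u‖ ≤ M * ‖u‖ := by
  let := realNormedSpace H
  have hu : ∀ u, u ∈ PL.squareDomain f := fun u => h ▸ Submodule.mem_top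
  let T : H →ₗ[ℝ] H :=
    { toFun := PL.strongIntegral f
      map_add' := fun u v => PL.strongIntegral_vec_add hf (hu u) (hu v)
      map_smul' := fun r u => PL.strongIntegral_vec_smul hf (algebraMap ℝ ℍ[ℝ]ᵐᵒᵖ r) (hu u) }
  have hc : Continuous T := T.continuous_of_isClosed_graph (by
    have hgr : (T.graph : Set (H × H)) = (PL.integral f).graph := by
      ext ⟨u, w⟩
      simp only [SetLike.mem_coe, PL.mem_graph_integral hf, hu u, true_and,
        LinearMap.mem_graph_iff]
      rfl
    rw [hgr]
    exact PL.opIsClosed_integral hf)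
  exact ⟨‖(⟨T, hc⟩ : H →L[ℝ] H)‖, fun u => (⟨T, hc⟩ : H →L[ℝ] H).le_opNorm u⟩

theorem isEssBounded_of_squareDomain_eq_top {f : halfPlane ι → ℍ[ℝ]} (hf : Measurable f)
    (h : PL.squareDomain f = ⊤) : PL.IsEssBounded f := by
  classical
  obtain ⟨M, hM⟩ := PL.exists_bound_of_squareDomain_eq_top hf h
  let k : ℝ≥0 := ⟨|M| + 1, by positivity⟩
  have hk : (k : ℝ) = |M| + 1 := rfl
  have hk0 : (0 : ℝ) < k := by rw [hk]; positivity
  have hE : MeasurableSet {q | (k : ℝ) < ‖f q‖} := measurableSet_lt measurable_const hf.norm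
  refine PL.isEssBounded_iff.mpr ⟨k, ContinuousLinearMap.ext fun u => ?_⟩
  set s := indicatorFunc hE with hs
  have hv : PL.P {q | (k : ℝ) < ‖f q‖} u = PL.strongIntegral s u := by
    rw [strongIntegral_simpleFunc, integralSimple_indicatorFunc]
  have hsu := PL.mem_squareDomain_simpleFunc s u
  have h1 : ‖PL.strongIntegral s u‖ₑ ≤
      ENNReal.ofReal (k : ℝ)⁻¹ * ‖PL.strongIntegral f (PL.strongIntegral s u)‖ₑ := by
    rw [PL.enorm_strongIntegral hf (h ▸ Submodule.mem_top),
      PL.enorm_strongIntegral s.measurable hsu,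
      PL.eLpNorm_strongIntegral hf s.measurable hsu]
    refine eLpNorm_le_mul_eLpNorm_of_ae_le_mul (Eventually.of_forall fun q => ?_) 2
    by_cases hq : (k : ℝ) < ‖f q‖
    · simp only [hs, indicatorFunc_apply, Set.mem_ofPred_eq, if_pos hq, norm_one, mul_one]
      rw [inv_mul_eq_div, one_le_div hk0]
      exact hq.le
    · simp [hs, indicatorFunc_apply, if_neg hq]
  rw [← ofReal_norm, ← ofReal_norm, ← ENNReal.ofReal_mul (by positivity),
    ENNReal.ofReal_le_ofReal_iff (by positivity), inv_mul_eq_div, le_div_iff₀ hk0] at h1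
  have h2 := hM (PL.strongIntegral s u)
  rw [hv, zero_apply, ← norm_eq_zero]
  have h3 := norm_nonneg (PL.strongIntegral s u)
  rw [hk] at h1
  nlinarith [mul_le_mul_of_nonneg_right (le_abs_self M) h3]

theorem squareDomain_eq_top_iff {f : halfPlane ι → ℍ[ℝ]} (hf : Measurable f) :
    PL.squareDomain f = ⊤ ↔ PL.IsEssBounded f :=
  ⟨PL.isEssBounded_of_squareDomain_eq_top hf, PL.squareDomain_eq_top_of_isEssBounded hf⟩

theorem opComp_integral_of_isEssBounded {f g : halfPlane ι → ℍ[ℝ]} (hf : Measurable f)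
    (hg : Measurable g) (h : PL.IsEssBounded g) :
    opComp (PL.integral f) (PL.integral g) = PL.integral (fun q => f q * g q) :=
  (PL.opComp_integral hf hg).2.2.mpr
    ((PL.squareDomain_eq_top_of_isEssBounded hg h).symm ▸ le_top)

theorem integral_add_of_isEssBounded {f g : halfPlane ι → ℍ[ℝ]} (hf : Measurable f)
    (hg : Measurable g) (h : PL.IsEssBounded f ∨ PL.IsEssBounded g) :
    PL.integral f + PL.integral g = PL.integral (fun q => f q + g q) := by
  refine (PL.integral_add hf hg).2.2.mpr fun u hu => ?_
  have hu := PL.mem_squareDomain.mp hu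
  rcases h with h | h
  · have h1 : u ∈ PL.squareDomain f :=
      PL.squareDomain_eq_top_of_isEssBounded hf h ▸ Submodule.mem_top
    refine ⟨h1, PL.mem_squareDomain.mpr ?_⟩
    convert hu.sub (PL.mem_squareDomain.mp h1) using 1
    ext1 q
    simp
  · have h1 : u ∈ PL.squareDomain g :=
      PL.squareDomain_eq_top_of_isEssBounded hg h ▸ Submodule.mem_top
    refine ⟨PL.mem_squareDomain.mpr ?_, h1⟩
    convert hu.sub (PL.mem_squareDomain.mp h1) using 1
    ext1 q
    simp

theorem integral_eq_integralBounded {f : halfPlane ι → ℍ[ℝ]} (hf : Measurable f)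
    (hC : ∃ C : ℝ, ∀ q, ‖f q‖ ≤ C) :
    PL.integral f = (PL.integralBounded f).toLinearMap.toPMap ⊤ := by
  obtain ⟨C, hC'⟩ := id hC
  refine LinearPMap.ext ?_ fun u hu _ => ?_
  · rw [PL.domain_integral hf]
    exact eq_top_iff.mpr fun u _ => PL.mem_squareDomain_of_bounded hf hC' u
  · rw [PL.integral_apply hf]
    exact (PL.integralBounded_apply hf hC u).symm

end Complete

/-! ### Change of variables -/

section ChangeOfVariables

variable {κ : ℍ[ℝ]} {Ψ : halfPlane ι → halfPlane κ}

/-- The image of an iqPVM under a Borel map of half planes. -/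
noncomputable def map (hΨ : Measurable Ψ) : IqPVM κ H where
  P E := PL.P (Ψ ⁻¹' E)
  L := PL.L
  P_univ := PL.P_univ
  P_inter E F hE hF := PL.P_inter _ _ (hΨ hE) (hΨ hF)
  P_iUnion E hE hd u := by
    rw [Set.preimage_iUnion]
    exact PL.P_iUnion _ (fun n => hΨ (hE n)) (fun i j hij => (hd hij).preimage Ψ) u
  P_nonneg E hE u := PL.P_nonneg _ (hΨ hE) u
  isLeftScalarMul := PL.isLeftScalarMul
  P_comm E hE q := PL.P_comm _ (hΨ hE) q

theorem measure_map (hΨ : Measurable Ψ) (u : H) :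
    (PL.map hΨ).measure u = (PL.measure u).map Ψ := by
  refine Measure.ext fun E hE => ?_
  rw [Measure.map_apply hΨ hE, measure_apply _ _ hE, measure_apply _ _ (hΨ hE)]
  rfl

theorem integralSimple_map_comp (hΨ : Measurable Ψ) (s : SimpleFunc (halfPlane κ) ℍ[ℝ]) (u : H) :
    (PL.map hΨ).integralSimple s u = PL.integralSimple (s.comp Ψ hΨ) u := by
  have h := PL.integralSimple_map (s.comp Ψ hΨ) id s.range (s.range_comp_subset_range hΨ) u
  exact ((PL.map hΨ).integralSimple_apply s u).trans h.symm

theorem eLpNorm_measure_map (hΨ : Measurable Ψ) {ξ : halfPlane κ → ℍ[ℝ]} (hξ : Measurable ξ)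
    (u : H) : eLpNorm ξ 2 ((PL.map hΨ).measure u) = eLpNorm (ξ ∘ Ψ) 2 (PL.measure u) := by
  rw [PL.measure_map hΨ, eLpNorm_map_measure hξ.aestronglyMeasurable hΨ.aemeasurable]

theorem integral_comp [CompleteSpace H] (hΨ : Measurable Ψ) {ξ : halfPlane κ → ℍ[ℝ]}
    (hξ : Measurable ξ) : PL.integral (ξ ∘ Ψ) = (PL.map hΨ).integral ξ := by
  have hd : ∀ u, u ∈ PL.squareDomain (ξ ∘ Ψ) ↔ u ∈ (PL.map hΨ).squareDomain ξ := fun u => by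
    rw [mem_squareDomain_iff_lt_top _ hξ, mem_squareDomain_iff_lt_top _ (hξ.comp hΨ),
      PL.eLpNorm_measure_map hΨ hξ]
  refine LinearPMap.eq_of_eq_graph (Submodule.ext fun ⟨u, w⟩ => ?_)
  rw [mem_graph_integral _ hξ, mem_graph_integral _ (hξ.comp hΨ), hd]
  refine and_congr_right fun hu => ?_
  obtain ⟨s, hs⟩ := (PL.map hΨ).exists_tendsto_strongIntegral hξ
  obtain ⟨h0, h1⟩ := hs u hu
  have h2 := PL.hasIntegral_strongIntegral (hξ.comp hΨ) ((hd u).mpr hu)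
    (fun n => (s n).comp Ψ hΨ)
    (h0.congr fun n => PL.eLpNorm_measure_map hΨ ((s n).measurable.sub hξ) u)
  simp only [PL.integralSimple_map_comp hΨ] at h1
  rw [tendsto_nhds_unique h1 h2]

end ChangeOfVariables

end QuaternionicIntegral.IqPVM

theorem mainTheorem12 {H : Type*} [NormedAddCommGroup H] [Module ℍ[ℝ]ᵐᵒᵖ H]
    [QInnerProductSpace H] [CompleteSpace H]
    (ι : ℍ[ℝ]) (_hι : ι ∈ imaginaryUnits) (PL : IqPVM ι H)
    (f g : halfPlane ι → ℍ[ℝ]) (_hf : Measurable f) (_hg : Measurable g) :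
    -- the operator `∫ f dPL` is well defined on the dense subspace `D_f`
    ((PL.integral f).domain = PL.squareDomain f ∧
      Dense (PL.squareDomain f : Set H) ∧
      (∀ u : (PL.integral f).domain,
        Tendsto (fun n : ℕ => PL.integralBounded (IqPVM.truncation f n) (u : H)) atTop
          (𝓝 (PL.integral f u))) ∧
      ((∃ C : ℝ, ∀ q, ‖f q‖ ≤ C) →
        PL.IsBoundedIntegral f (PL.integralBounded f) ∧
        PL.integral f = (PL.integralBounded f).toLinearMap.toPMap ⊤)) ∧
    -- (a) products
    ((opComp (PL.integral f) (PL.integral g)).domain =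
        PL.squareDomain g ⊓ PL.squareDomain (fun q => f q * g q) ∧
      opComp (PL.integral f) (PL.integral g) ≤ PL.integral (fun q => f q * g q) ∧
      (opComp (PL.integral f) (PL.integral g) = PL.integral (fun q => f q * g q) ↔
        PL.squareDomain (fun q => f q * g q) ≤ PL.squareDomain g)) ∧
    -- (b) sums
    ((PL.integral f + PL.integral g).domain = PL.squareDomain f ⊓ PL.squareDomain g ∧
      PL.integral f + PL.integral g ≤ PL.integral (fun q => f q + g q) ∧
      (PL.integral f + PL.integral g = PL.integral (fun q => f q + g q) ↔
        PL.squareDomain (fun q => f q + g q) ≤ PL.squareDomain f ⊓ PL.squareDomain g)) ∧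
    -- (c) adjoint and closedness
    (PL.squareDomain f = PL.squareDomain (fun q => star (f q)) ∧
      opAdjoint (PL.integral f) = PL.integral (fun q => star (f q)) ∧
      OpIsClosed (PL.integral f)) ∧
    -- (d) normality
    (OpIsNormal (PL.integral f) ∧
      opComp (opAdjoint (PL.integral f)) (PL.integral f) =
        PL.integral (fun q => ((‖f q‖ ^ 2 : ℝ) : ℍ[ℝ])) ∧
      opComp (PL.integral f) (opAdjoint (PL.integral f)) =
        PL.integral (fun q => ((‖f q‖ ^ 2 : ℝ) : ℍ[ℝ]))) ∧
    -- (e) essential boundedness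
    ((PL.squareDomain f = ⊤ ↔ PL.IsEssBounded f) ∧
      (PL.IsEssBounded g →
        opComp (PL.integral f) (PL.integral g) = PL.integral (fun q => f q * g q)) ∧
      (PL.IsEssBounded f ∨ PL.IsEssBounded g →
        PL.integral f + PL.integral g = PL.integral (fun q => f q + g q))) ∧
    -- (f) change of variables
    (∀ κ ∈ imaginaryUnits, ∀ Ψ : halfPlane ι → halfPlane κ, Measurable Ψ →
      ∃ QL : IqPVM κ H, (QL.P = fun E => PL.P (Ψ ⁻¹' E)) ∧ QL.L = PL.L ∧
        ∀ ξ : halfPlane κ → ℍ[ℝ], Measurable ξ → PL.integral (ξ ∘ Ψ) = QL.integral ξ) := by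
  refine ⟨⟨PL.domain_integral _hf, PL.dense_squareDomain _hf, fun u => ?_, fun hC =>
      ⟨PL.isBoundedIntegral_integralBounded _hf hC, PL.integral_eq_integralBounded _hf hC⟩⟩,
    PL.opComp_integral _hf _hg, PL.integral_add _hf _hg,
    ⟨PL.squareDomain_star f _hf, PL.opAdjoint_integral _hf, PL.opIsClosed_integral _hf⟩,
    ⟨(PL.opComp_self_adjoint _hf).trans (PL.opComp_adjoint_self _hf).symm,
      PL.opComp_adjoint_self _hf, PL.opComp_self_adjoint _hf⟩,
    ⟨PL.squareDomain_eq_top_iff _hf, PL.opComp_integral_of_isEssBounded _hf _hg,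
      PL.integral_add_of_isEssBounded _hf _hg⟩,
    fun κ _ Ψ hΨ => ⟨PL.map hΨ, rfl, rfl, fun ξ hξ => PL.integral_comp hΨ hξ⟩⟩
  rw [PL.integral_apply _hf]
  exact PL.tendsto_integralBounded_truncation _hf (PL.domain_integral _hf ▸ u.2)
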